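/- Let $d\ge 1$, and let $V=(V(z))_{z\in\mathbb{Z}^d}$ be independent, identically distributed random variables such that almost surely $\epsilon\le V(z)\le M$ for every $z$, where $\epsilon>0$ and $0<M<\infty$. Let $H$ be the random Schrödinger operator on $\ell^2(\mathbb{Z}^d)$, \[ (H\psi)(x) = (1+V(x))\psi(x) - \frac{1}{2d}\sum_{y\sim x}\psi(y), \] where $y\sim x$ means $\|y-x\|_1=1$; let $G=H^{-1}$, with matrix elements $G(x,y)$, and set \[ \rho(x)=\log\frac{\sqrt{G(0,0)\,G(x,x)}}{G(0,x)},\qquad \mu(x)=\mathbb{E}\,\rho(x),\qquad x\in\mathbb{Z}^d. \] Then there are an absolute constant $C>0$ and a constant $C(\epsilon,M)>0$ depending only on $\epsilon$ and $M$ (in particular not on $d$, on $x$, or on the common distribution of the $V(z)$) such that for every $x\in\mathbb{Z}^d$ the random variable $\rho(x)$ is integrable, and for every $t\ge 0$ \[ \mathbb{P}\{\rho(x)\le\mu(x)-t\}\le C\exp\left\{-\frac{t^2}{C(\epsilon,M)(\mu(x)+1)}\right\} \] and \[ \mathbb{P}\{\rho(x)\ge\mu(x)+t\}\le C\exp\left\{-\frac{t^2}{C(\epsilon,M)(\mu(x)+t+1)}\right\}.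 \] -/

import Mathlib

open MeasureTheory ProbabilityTheory

noncomputable section

namespace RandomSchrodinger

/-- The lattice `ℤ^d`. -/
abbrev Lattice (d : ℕ) : Type := Fin d → ℤ

/-- The real Hilbert space `ℓ²(ℤ^d)`. -/
abbrev EllTwo (d : ℕ) : Type := lp (fun _ : Lattice d => ℝ) 2

/-- The difference expression `(Hψ)(x) = (1 + v(x)) ψ(x) - (1/2d) ∑_{y ∼ x} ψ(y)`, on all functions
on `ℤ^d`; the neighbours of `x` are the `2d` points `x ± e_i`. -/
def schrodingerExpr {d : ℕ} (v : Lattice d → ℝ) : (Lattice d → ℝ) →ₗ[ℝ] (Lattice d → ℝ) where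
  toFun ψ x := (1 + v x) * ψ x
    - 1 / (2 * (d : ℝ)) * ∑ i : Fin d, (ψ (x + Pi.single i 1) + ψ (x - Pi.single i 1))
  map_add' ψ φ := by
    funext x
    simp only [Pi.add_apply, Finset.sum_add_distrib]
    ring
  map_smul' c ψ := by
    funext x
    simp only [Pi.smul_apply, smul_eq_mul, RingHom.id_apply, ← mul_add, ← Finset.mul_sum]
    ring

/-- The Schrödinger operator `H = -(1/2d) Δ + v` on `ℓ²(ℤ^d)`, with its maximal domain
`{ψ ∈ ℓ² | Hψ ∈ ℓ²}` (which is all of `ℓ²` when `v` is bounded). -/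
def schrodinger {d : ℕ} (v : Lattice d → ℝ) : EllTwo d →ₗ.[ℝ] EllTwo d where
  domain :=
    { carrier := {ψ | Memℓp (schrodingerExpr v ψ) 2}
      add_mem' := by
        intro ψ φ hψ hφ
        simp only [Set.mem_ofPred_eq, lp.coeFn_add, map_add] at *
        exact hψ.add hφ
      zero_mem' := by
        simp only [Set.mem_ofPred_eq, lp.coeFn_zero, map_zero]
        exact zero_memℓp
      smul_mem' := by
        intro c ψ hψ
        simp only [Set.mem_ofPred_eq, lp.coeFn_smul, map_smul] at *
        exact hψ.const_smul c }
  toFun :=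
    { toFun := fun ψ => ⟨schrodingerExpr v (ψ : EllTwo d), ψ.2⟩
      map_add' := by
        intro ψ φ
        exact lp.ext (map_add (schrodingerExpr v) (⇑(ψ : EllTwo d)) (⇑(φ : EllTwo d)))
      map_smul' := by
        intro c ψ
        exact lp.ext (map_smul (schrodingerExpr v) c (⇑(ψ : EllTwo d))) }

open Classical in
/-- The Green function `G(x, y)`, i.e. the matrix element `(H⁻¹ δ_y)(x)` of the inverse operator
(with value `0` if `δ_y` is not in the range of `H`). -/
def green {d : ℕ} (v : Lattice d → ℝ) (x y : Lattice d) : ℝ :=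
  if h : (lp.single 2 y (1 : ℝ) : EllTwo d) ∈ (schrodinger v).inverse.domain then
    ((schrodinger v).inverse ⟨lp.single 2 y (1 : ℝ), h⟩ : EllTwo d) x
  else 0

/-- The metric `ρ(x, y) = log (√(G(x,x) G(y,y)) / G(x,y))`. -/
def rho {d : ℕ} (v : Lattice d → ℝ) (x y : Lattice d) : ℝ :=
  Real.log (√(green v x x * green v y y) / green v x y)

end RandomSchrodinger

end

/-! The variable `W = ρ + 1` is self-bounding: replacing one value of the potential changes it by an
amount whose squares, maximised over the new value and summed over all sites, are at most a constant
times `W` itself. The entropy method turns this into Bernstein-type tails with variance proxy of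
order `E W = μ + 1`.

The size of one change comes from rank-one perturbation (`green_update`). Changing the potential at
`y` multiplies `G(0,x)` by `1 - κ I(y)`, where `I(y) = G(0,y) G(y,x) / G(0,x)` and `κ` is bounded.
The diagonal entries change in the same way, with smaller influences by `green_mul_green_le`, so `ρ`
moves by `O(I(y))` (`abs_rho_update_sub_le`). Also `I(y) ≤ G(y,y) ≤ 1/ε`, so the squares sum to `O(∑
I(y))`.

The sum of influences is the logarithmic derivative of `G(0,x)` when the whole potential is lowered.
As `log G` is convex in this energy shift, and lowering by `ε/2` still leaves a Green function
bounded by `2/ε`, one gets `(ε/2) ∑ I(y) ≤ log(2/ε) - log G(0,x) ≤ ρ + const`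
(`tangent_le_greenIter`, `sum_influence_le`). Only `ε` and `M` enter, because the hopping term is an
average.

On the probabilistic side, a modified logarithmic Sobolev inequality for one coordinate is
tensorized (`entropyExp_pi_le`) and fed into Herbst's argument (`mgf_le_of_entropyExp_le`). Since
`ρ` is continuous in the product topology, infinitely many coordinates are reached as a limit of
finitely many. -/

namespace RandomSchrodinger

/-! ### The averaging operator and the maximum principle -/

/-- The average of a function over the neighbours of a lattice point. -/
noncomputable def hop {d : ℕ} (ψ : Lattice d → ℝ) (a : Lattice d) : ℝ :=
  1 / (2 * (d : ℝ)) * ∑ i : Fin d, (ψ (a + Pi.single i 1) + ψ (a - Pi.single i 1))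

theorem schrodingerExpr_apply {d : ℕ} (v ψ : Lattice d → ℝ) (a : Lattice d) :
    schrodingerExpr v ψ a = (1 + v a) * ψ a - hop ψ a := rfl

theorem hop_mono {d : ℕ} {ψ φ : Lattice d → ℝ} (h : ∀ z, ψ z ≤ φ z) (a : Lattice d) :
    hop ψ a ≤ hop φ a := by
  unfold hop
  gcongr <;> exact h _

theorem hop_const {d : ℕ} (hd : 0 < d) (c : ℝ) (a : Lattice d) : hop (fun _ => c) a = c := by
  have : (d : ℝ) ≠ 0 := by positivity
  simp only [hop, Finset.sum_const, Finset.card_univ, Fintype.card_fin, nsmul_eq_mul]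
  field_simp
  ring

theorem hop_add {d : ℕ} (ψ φ : Lattice d → ℝ) (a : Lattice d) :
    hop (fun z => ψ z + φ z) a = hop ψ a + hop φ a := by
  simp only [hop, ← mul_add, ← Finset.sum_add_distrib]
  congr 1
  exact Finset.sum_congr rfl fun i _ => by ring

theorem hop_const_mul {d : ℕ} (c : ℝ) (ψ : Lattice d → ℝ) (a : Lattice d) :
    hop (fun z => c * ψ z) a = c * hop ψ a := by
  simp only [hop, Finset.mul_sum]
  exact Finset.sum_congr rfl fun i _ => by ring

theorem hop_nonneg {d : ℕ} {ψ : Lattice d → ℝ} (h : ∀ z, 0 ≤ ψ z) (a : Lattice d) :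
    0 ≤ hop ψ a := by
  unfold hop
  have : ∀ i : Fin d, 0 ≤ ψ (a + Pi.single i 1) + ψ (a - Pi.single i 1) :=
    fun i => add_nonneg (h _) (h _)
  exact mul_nonneg (by positivity) (Finset.sum_nonneg fun i _ => this i)

theorem hop_le {d : ℕ} (hd : 0 < d) {ψ : Lattice d → ℝ} {c : ℝ} (h : ∀ z, ψ z ≤ c)
    (a : Lattice d) : hop ψ a ≤ c := (hop_mono h a).trans_eq (hop_const hd c a)

theorem le_hop {d : ℕ} (hd : 0 < d) {ψ : Lattice d → ℝ} {c : ℝ} (h : ∀ z, c ≤ ψ z)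
    (a : Lattice d) : c ≤ hop ψ a := (hop_const hd c a).symm.trans_le (hop_mono h a)

theorem tendsto_hop {d : ℕ} {ι : Type*} {l : Filter ι} {ψ : ι → Lattice d → ℝ}
    {φ : Lattice d → ℝ} (h : ∀ z, Filter.Tendsto (fun k => ψ k z) l (nhds (φ z))) (a : Lattice d) :
    Filter.Tendsto (fun k => hop (ψ k) a) l (nhds (hop φ a)) :=
  (tendsto_finsetSum _ fun _ _ => (h _).add (h _)).const_mul _

/-- The maximum principle. -/
theorem nonneg_of_schrodingerExpr_nonneg {d : ℕ} (hd : 0 < d) {ε : ℝ} (hε : 0 < ε)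
    {v u : Lattice d → ℝ} (hv : ∀ z, ε ≤ v z) {B : ℝ} (hB : ∀ z, -B ≤ u z)
    (hu : ∀ z, u z < 0 → 0 ≤ schrodingerExpr v u z) (a : Lattice d) : 0 ≤ u a := by
  by_contra! ha
  have hbdd : BddBelow (Set.range u) := ⟨-B, by rintro _ ⟨z, rfl⟩; exact hB z⟩
  have hm : ∀ z, (⨅ z, u z) ≤ u z := ciInf_le hbdd
  set m := ⨅ z, u z
  have hm0 : m < 0 := (hm a).trans_lt ha
  -- The infimum `m` need not be attained. Instead, every value is at least `m / (1 + ε)`, which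
  -- exceeds `m` when `m < 0`, contradicting that `m` is the infimum.
  have key : ∀ z, m / (1 + ε) ≤ u z := by
    intro z
    rw [div_le_iff₀ (by linarith)]
    rcases lt_or_ge (u z) 0 with hz | hz
    · have h1 := hu z hz
      rw [schrodingerExpr_apply] at h1
      have h2 := le_hop hd hm z
      nlinarith [hv z]
    · nlinarith
  have := le_ciInf key
  rw [div_le_iff₀ (by linarith)] at this
  change m ≤ m * (1 + ε) at this
  nlinarith

theorem le_of_schrodingerExpr_le {d : ℕ} (hd : 0 < d) {ε : ℝ} (hε : 0 < ε)
    {v u w : Lattice d → ℝ} (hv : ∀ z, ε ≤ v z) {B : ℝ} (hu : ∀ z, |u z| ≤ B)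
    {B' : ℝ} (hw : ∀ z, |w z| ≤ B')
    (h : ∀ z, schrodingerExpr v u z ≤ schrodingerExpr v w z) (a : Lattice d) : u a ≤ w a := by
  have := nonneg_of_schrodingerExpr_nonneg hd hε (u := w - u) hv (B := B + B') ?_ ?_ a
  · simpa using this
  · intro z
    have h1 := abs_le.1 (hu z)
    have h2 := abs_le.1 (hw z)
    simp only [Pi.sub_apply]
    linarith
  · intro z _
    rw [map_sub]
    simpa using h z

theorem eq_of_schrodingerExpr_eq {d : ℕ} (hd : 0 < d) {ε : ℝ} (hε : 0 < ε)
    {v u w : Lattice d → ℝ} (hv : ∀ z, ε ≤ v z) {B : ℝ} (hu : ∀ z, |u z| ≤ B)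
    {B' : ℝ} (hw : ∀ z, |w z| ≤ B')
    (h : schrodingerExpr v u = schrodingerExpr v w) : u = w := by
  funext a
  exact le_antisymm (le_of_schrodingerExpr_le hd hε hv hu hw (fun z => by rw [h]) a)
    (le_of_schrodingerExpr_le hd hε hv hw hu (fun z => by rw [h]) a)

/-! ### Jacobi iteration and construction of the Green function -/

/-- Jacobi iteration for the equation `Hu = f`, with a source that may depend on the step. -/
noncomputable def jacobi {d : ℕ} (v : Lattice d → ℝ) (f : ℕ → Lattice d → ℝ) : ℕ → Lattice d → ℝ
  | 0 => fun _ => 0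
  | k + 1 => fun a => (hop (jacobi v f k) a + f k a) / (1 + v a)

theorem jacobi_succ {d : ℕ} (v : Lattice d → ℝ) (f : ℕ → Lattice d → ℝ) (k : ℕ) (a : Lattice d) :
    jacobi v f (k + 1) a = (hop (jacobi v f k) a + f k a) / (1 + v a) := rfl

theorem jacobi_nonneg {d : ℕ} {v : Lattice d → ℝ} (hv : ∀ z, 0 < v z) {f : ℕ → Lattice d → ℝ}
    (hf : ∀ k z, 0 ≤ f k z) (k : ℕ) (a : Lattice d) : 0 ≤ jacobi v f k a := by
  induction k generalizing a with
  | zero => exact le_rfl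
  | succ k ih =>
    exact div_nonneg (add_nonneg (hop_nonneg ih a) (hf k a)) (by linarith [hv a])

theorem jacobi_le {d : ℕ} (hd : 0 < d) {ε : ℝ} (hε : 0 < ε) {v : Lattice d → ℝ}
    (hv : ∀ z, ε ≤ v z) {f : ℕ → Lattice d → ℝ} {B : ℝ} (hB : 0 ≤ B) (hf : ∀ k z, f k z ≤ B)
    (k : ℕ) (a : Lattice d) : jacobi v f k a ≤ B / ε := by
  induction k generalizing a with
  | zero => exact div_nonneg hB hε.le
  | succ k ih =>
    rw [jacobi_succ, div_le_iff₀ (by linarith [hv a])]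
    have h1 := hop_le hd ih a
    have h2 : B / ε * ε = B := by field_simp
    have h3 : 0 ≤ B / ε := by positivity
    nlinarith [hf k a, hv a]

theorem jacobi_mono {d : ℕ} {v : Lattice d → ℝ} (hv : ∀ z, 0 < v z) {f : ℕ → Lattice d → ℝ}
    (hf : ∀ k z, 0 ≤ f k z) (hm : ∀ k z, f k z ≤ f (k + 1) z) (k : ℕ) (a : Lattice d) :
    jacobi v f k a ≤ jacobi v f (k + 1) a := by
  induction k generalizing a with
  | zero => exact jacobi_nonneg hv hf 1 a
  | succ k ih =>
    rw [jacobi_succ, jacobi_succ]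
    have := hv a
    gcongr
    · exact hop_mono ih a
    · exact hm k a

theorem exists_tendsto_jacobi {d : ℕ} (hd : 0 < d) {ε : ℝ} (hε : 0 < ε) {v : Lattice d → ℝ}
    (hv : ∀ z, ε ≤ v z) {f : ℕ → Lattice d → ℝ} {B : ℝ} (hf : ∀ k z, 0 ≤ f k z)
    (hfB : ∀ k z, f k z ≤ B) (hm : ∀ k z, f k z ≤ f (k + 1) z) {F : Lattice d → ℝ}
    (hF : ∀ z, Filter.Tendsto (fun k => f k z) Filter.atTop (nhds (F z))) :
    ∃ u : Lattice d → ℝ, (∀ z, Filter.Tendsto (fun k => jacobi v f k z) Filter.atTop (nhds (u z))) ∧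
      (∀ z, 0 ≤ u z) ∧ (∀ z, u z ≤ B / ε) ∧ (∀ z, schrodingerExpr v u z = F z) := by
  have hv0 : ∀ z, 0 < v z := fun z => hε.trans_le (hv z)
  have hB : 0 ≤ B := (hf 0 0).trans (hfB 0 0)
  have hle := jacobi_le hd hε hv hB hfB
  have hlim : ∀ z, Filter.Tendsto (fun k => jacobi v f k z) Filter.atTop
      (nhds (⨆ k, jacobi v f k z)) := fun z =>
    tendsto_atTop_ciSup (monotone_nat_of_le_succ fun k => jacobi_mono hv0 hf hm k z)
      ⟨B / ε, by rintro _ ⟨k, rfl⟩; exact hle k z⟩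
  refine ⟨_, hlim, fun z => ge_of_tendsto' (hlim z) fun k => jacobi_nonneg hv0 hf k z,
    fun z => le_of_tendsto' (hlim z) fun k => hle k z, fun z => ?_⟩
  have h1 := (hlim z).comp (Filter.tendsto_add_atTop_nat 1)
  have h2 := ((tendsto_hop hlim z).add (hF z)).div_const (1 + v z)
  have h3 := tendsto_nhds_unique h1 h2
  have : (1 + v z) ≠ 0 := by linarith [hv0 z]
  rw [schrodingerExpr_apply, h3]
  field_simp
  ring

/-- The point mass at `y`. -/
noncomputable def pointMass {d : ℕ} (y : Lattice d) : Lattice d → ℝ := Pi.single y 1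

theorem pointMass_self {d : ℕ} (y : Lattice d) : pointMass y y = 1 := by simp [pointMass]

theorem pointMass_ne {d : ℕ} {y z : Lattice d} (h : z ≠ y) : pointMass y z = 0 := by
  simp [pointMass, h]

theorem pointMass_nonneg {d : ℕ} (y z : Lattice d) : 0 ≤ pointMass y z := by
  by_cases h : z = y
  · simp [h, pointMass_self]
  · simp [pointMass_ne h]

theorem pointMass_le {d : ℕ} (y z : Lattice d) : pointMass y z ≤ 1 := by
  by_cases h : z = y
  · simp [h, pointMass_self]
  · simp [pointMass_ne h]

/-- Jacobi iterates for the Green function with pole `y`. -/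
noncomputable def greenIter {d : ℕ} (v : Lattice d → ℝ) (y : Lattice d) : ℕ → Lattice d → ℝ :=
  jacobi v fun _ => pointMass y

theorem summable_shift {d : ℕ} {u : Lattice d → ℝ} (hu : Summable u) (e : Lattice d) :
    Summable fun z => u (z + e) := (Equiv.addRight e).summable_iff.2 hu

theorem tsum_shift {d : ℕ} (u : Lattice d → ℝ) (e : Lattice d) :
    ∑' z, u (z + e) = ∑' z, u z := (Equiv.addRight e).tsum_eq u

theorem summable_shift_sub {d : ℕ} {u : Lattice d → ℝ} (hu : Summable u) (e : Lattice d) :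
    Summable fun z => u (z - e) := (Equiv.subRight e).summable_iff.2 hu

theorem tsum_shift_sub {d : ℕ} (u : Lattice d → ℝ) (e : Lattice d) :
    ∑' z, u (z - e) = ∑' z, u z := (Equiv.subRight e).tsum_eq u

theorem summable_hop {d : ℕ} {u : Lattice d → ℝ} (hu : Summable u) : Summable (hop u) := by
  refine (summable_sum fun i _ => ?_).mul_left _
  refine (summable_shift hu _).add ?_
  exact summable_shift_sub hu _

theorem tsum_hop {d : ℕ} (hd : 0 < d) {u : Lattice d → ℝ} (hu : Summable u) :
    ∑' z, hop u z = ∑' z, u z := by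
  have h2 : ∀ i : Fin d, Summable fun z : Lattice d => u (z - Pi.single i 1) := fun i =>
    summable_shift_sub hu _
  have h1 : ∀ i : Fin d, ∑' z : Lattice d, (u (z + Pi.single i 1) + u (z - Pi.single i 1))
      = 2 * ∑' z, u z := by
    intro i
    rw [(summable_shift hu _).tsum_add (h2 i), tsum_shift, tsum_shift_sub]
    ring
  unfold hop
  rw [tsum_mul_left, Summable.tsum_finsetSum fun i _ => (summable_shift hu _).add (h2 i)]
  simp only [h1, Finset.sum_const, Finset.card_univ, Fintype.card_fin, nsmul_eq_mul]
  have : (d : ℝ) ≠ 0 := by positivity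
  field_simp

theorem summable_pointMass {d : ℕ} (y : Lattice d) : Summable (pointMass y) :=
  summable_of_ne_finset_zero (s := {y}) fun z hz => pointMass_ne (by simpa using hz)

theorem tsum_pointMass {d : ℕ} (y : Lattice d) : ∑' z, pointMass y z = 1 := by
  rw [tsum_eq_single y fun z hz => pointMass_ne hz, pointMass_self]

/-- Averaging preserves the sum over the lattice, so the masses satisfy `m_{k+1} ≤ (m_k + 1) / (1 +
ε)`, whose fixed point is `1/ε`. The uniform bound makes the limit summable. -/
theorem summable_greenIter {d : ℕ} (hd : 0 < d) {ε : ℝ} (hε : 0 < ε) {v : Lattice d → ℝ}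
    (hv : ∀ z, ε ≤ v z) (y : Lattice d) (k : ℕ) :
    Summable (greenIter v y k) ∧ ∑' z, greenIter v y k z ≤ 1 / ε := by
  have hv0 : ∀ z, 0 < v z := fun z => hε.trans_le (hv z)
  induction k with
  | zero =>
    have : greenIter v y 0 = fun _ => 0 := rfl
    rw [this]
    exact ⟨summable_zero, by simpa using hε.le⟩
  | succ k ih =>
    have hs := ((summable_hop ih.1).add (summable_pointMass y)).div_const (1 + ε)
    have hle : ∀ z, greenIter v y (k + 1) z ≤ (hop (greenIter v y k) z + pointMass y z) / (1 + ε) := by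
      intro z
      have := hv z
      have h0 := add_nonneg (hop_nonneg (jacobi_nonneg hv0 (fun _ => pointMass_nonneg y) k) z)
        (pointMass_nonneg y z)
      exact div_le_div_of_nonneg_left h0 (by linarith) (by linarith)
    have h0 := jacobi_nonneg hv0 (fun _ => pointMass_nonneg y) (k + 1)
    have hs' : Summable (greenIter v y (k + 1)) := Summable.of_nonneg_of_le h0 hle hs
    refine ⟨hs', (hs'.tsum_le_tsum hle hs).trans ?_⟩
    rw [tsum_div_const, (summable_hop ih.1).tsum_add (summable_pointMass y), tsum_hop hd ih.1,
      tsum_pointMass, div_le_iff₀ (by linarith)]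
    have : 1 / ε * (1 + ε) = 1 / ε + 1 := by field_simp
    linarith [ih.2]

theorem exists_greenIter_limit {d : ℕ} (hd : 0 < d) {ε : ℝ} (hε : 0 < ε) {v : Lattice d → ℝ}
    (hv : ∀ z, ε ≤ v z) (y : Lattice d) :
    ∃ u : Lattice d → ℝ,
      (∀ z, Filter.Tendsto (fun k => greenIter v y k z) Filter.atTop (nhds (u z))) ∧
      (∀ z, 0 ≤ u z) ∧ (∀ z, u z ≤ 1 / ε) ∧ (schrodingerExpr v u = pointMass y) ∧
      Summable u := by
  obtain ⟨u, h1, h2, h3, h4⟩ := exists_tendsto_jacobi hd hε hv (f := fun _ => pointMass y) (B := 1)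
    (fun _ => pointMass_nonneg y) (fun _ => pointMass_le y) (fun _ _ => le_rfl)
    (fun z => tendsto_const_nhds)
  refine ⟨u, h1, h2, h3, funext h4, summable_of_sum_le (c := 1 / ε) h2 fun S => ?_⟩
  refine le_of_tendsto' (tendsto_finsetSum S fun z _ => h1 z) fun k => ?_
  have := summable_greenIter hd hε hv y k
  exact (this.1.sum_le_tsum S fun z _ => jacobi_nonneg (fun z => hε.trans_le (hv z))
    (fun _ => pointMass_nonneg y) k z).trans this.2

theorem ker_schrodinger {d : ℕ} (hd : 0 < d) {ε : ℝ} (hε : 0 < ε) {v : Lattice d → ℝ}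
    (hv : ∀ z, ε ≤ v z) : LinearMap.ker (schrodinger v).toFun = ⊥ := by
  rw [LinearMap.ker_eq_bot']
  intro ψ hψ
  have h1 : schrodingerExpr v (ψ : EllTwo d) = schrodingerExpr v 0 := by
    rw [map_zero]
    exact congrArg (fun φ : EllTwo d => (φ : Lattice d → ℝ)) hψ
  have h2 := eq_of_schrodingerExpr_eq hd hε hv (B := ‖(ψ : EllTwo d)‖) (B' := 0)
    (fun z => lp.norm_apply_le_norm (by norm_num) (ψ : EllTwo d) z) (fun z => by simp) h1
  exact Subtype.ext (lp.ext h2)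

theorem green_eq_of_schrodingerExpr {d : ℕ} (hd : 0 < d) {ε : ℝ} (hε : 0 < ε) {v : Lattice d → ℝ}
    (hv : ∀ z, ε ≤ v z) {y : Lattice d} {u : Lattice d → ℝ} (hu : Memℓp u 2)
    (h : schrodingerExpr v u = pointMass y) (a : Lattice d) : green v a y = u a := by
  have hδ : ((lp.single 2 y (1 : ℝ) : EllTwo d) : Lattice d → ℝ) = pointMass y := by
    rw [lp.coeFn_single]; rfl
  have hdom : (⟨u, hu⟩ : EllTwo d) ∈ (schrodinger v).domain := by
    change Memℓp (schrodingerExpr v u) 2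
    rw [h, ← hδ]
    exact lp.memℓp _
  have happ : schrodinger v ⟨⟨u, hu⟩, hdom⟩ = lp.single 2 y (1 : ℝ) := by
    refine lp.ext ?_
    rw [hδ]
    exact h
  have hmem : (lp.single 2 y (1 : ℝ) : EllTwo d) ∈ (schrodinger v).inverse.domain := by
    rw [LinearPMap.inverse_domain]
    exact ⟨⟨⟨u, hu⟩, hdom⟩, happ⟩
  unfold green
  rw [dif_pos hmem, LinearPMap.inverse_apply_eq (ker_schrodinger hd hε hv) (x := ⟨⟨u, hu⟩, hdom⟩) happ]

theorem memℓp_two_of_summable {d : ℕ} {u : Lattice d → ℝ} (hs : Summable u) (h0 : ∀ z, 0 ≤ u z)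
    {B : ℝ} (hB : ∀ z, u z ≤ B) : Memℓp u 2 := by
  refine memℓp_gen ?_
  refine Summable.of_nonneg_of_le (fun z => by positivity) (fun z => ?_) (hs.mul_left B)
  rw [Real.norm_of_nonneg (h0 z)]
  simp only [ENNReal.toReal_ofNat, Real.rpow_ofNat, pow_two]
  exact mul_le_mul_of_nonneg_right (hB z) (h0 z)

/-- The limit of the iterates is summable and bounded, hence in `ℓ²` and in the domain of `H`;
injectivity of `H` identifies it with the operator-theoretic Green function. Later arguments use
only these properties. -/
theorem green_spec {d : ℕ} (hd : 0 < d) {ε : ℝ} (hε : 0 < ε) {v : Lattice d → ℝ}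
    (hv : ∀ z, ε ≤ v z) (y : Lattice d) :
    (∀ z, Filter.Tendsto (fun k => greenIter v y k z) Filter.atTop (nhds (green v z y))) ∧
      (∀ z, 0 ≤ green v z y) ∧ (∀ z, green v z y ≤ 1 / ε) ∧
      (schrodingerExpr v (fun z => green v z y) = pointMass y) ∧
      Summable (fun z => green v z y) := by
  obtain ⟨u, h1, h2, h3, h4, h5⟩ := exists_greenIter_limit hd hε hv y
  have : (fun z => green v z y) = u :=
    funext (green_eq_of_schrodingerExpr hd hε hv (memℓp_two_of_summable h5 h2 h3) h4)
  have h : ∀ z, green v z y = u z := congrFun this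
  rw [this]
  simp only [h]
  exact ⟨h1, h2, h3, h4, h5⟩

theorem abs_green_le {d : ℕ} (hd : 0 < d) {ε : ℝ} (hε : 0 < ε) {v : Lattice d → ℝ}
    (hv : ∀ z, ε ≤ v z) (y z : Lattice d) : |green v z y| ≤ 1 / ε := by
  obtain ⟨-, h1, h2, -⟩ := green_spec hd hε hv y
  rw [abs_of_nonneg (h1 z)]
  exact h2 z

theorem schrodingerExpr_green {d : ℕ} (hd : 0 < d) {ε : ℝ} (hε : 0 < ε) {v : Lattice d → ℝ}
    (hv : ∀ z, ε ≤ v z) (y : Lattice d) :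
    schrodingerExpr v (fun z => green v z y) = pointMass y := (green_spec hd hε hv y).2.2.2.1

theorem hop_green {d : ℕ} (hd : 0 < d) {ε : ℝ} (hε : 0 < ε) {v : Lattice d → ℝ}
    (hv : ∀ z, ε ≤ v z) (y a : Lattice d) :
    hop (fun z => green v z y) a = (1 + v a) * green v a y - pointMass y a := by
  rw [← schrodingerExpr_green hd hε hv y, schrodingerExpr_apply]
  ring

theorem green_nonneg {d : ℕ} (hd : 0 < d) {ε : ℝ} (hε : 0 < ε) {v : Lattice d → ℝ}
    (hv : ∀ z, ε ≤ v z) (z y : Lattice d) : 0 ≤ green v z y := (green_spec hd hε hv y).2.1 z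

/-! ### Symmetry, submultiplicativity and positivity of the Green function -/

theorem summable_mul_of_abs_le {ι : Type*} {u w : ι → ℝ} (hu : Summable u) {B : ℝ}
    (hw : ∀ z, |w z| ≤ B) : Summable fun z => u z * w z := by
  refine Summable.of_norm_bounded (hu.abs.mul_right B) fun z => ?_
  rw [Real.norm_eq_abs, abs_mul]
  exact mul_le_mul_of_nonneg_left (hw z) (abs_nonneg _)

theorem tsum_hop_mul {d : ℕ} {u w : Lattice d → ℝ} (hu : Summable u) {B : ℝ}
    (hw : ∀ z, |w z| ≤ B) : ∑' z, hop u z * w z = ∑' z, u z * hop w z := by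
  have e1 : ∀ e : Lattice d, Summable fun z => u (z + e) * w z := fun e =>
    summable_mul_of_abs_le (summable_shift hu e) hw
  have e2 : ∀ e : Lattice d, Summable fun z => u (z - e) * w z := fun e =>
    summable_mul_of_abs_le (summable_shift_sub hu e) hw
  have e3 : ∀ e : Lattice d, Summable fun z => u z * w (z + e) := fun e =>
    summable_mul_of_abs_le hu fun z => hw (z + e)
  have e4 : ∀ e : Lattice d, Summable fun z => u z * w (z - e) := fun e =>
    summable_mul_of_abs_le hu fun z => hw (z - e)
  have s1 : ∀ e : Lattice d, ∑' z, u (z + e) * w z = ∑' z, u z * w (z - e) := fun e => by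
    simpa using tsum_shift (fun z => u z * w (z - e)) e
  have s2 : ∀ e : Lattice d, ∑' z, u (z - e) * w z = ∑' z, u z * w (z + e) := fun e => by
    simpa using tsum_shift_sub (fun z => u z * w (z + e)) e
  have h1 : ∀ z, hop u z * w z = 1 / (2 * (d : ℝ)) * ∑ i : Fin d,
      (u (z + Pi.single i 1) * w z + u (z - Pi.single i 1) * w z) := fun z => by
    simp only [hop, mul_assoc, Finset.sum_mul, add_mul]
  have h2 : ∀ z, u z * hop w z = 1 / (2 * (d : ℝ)) * ∑ i : Fin d,
      (u z * w (z + Pi.single i 1) + u z * w (z - Pi.single i 1)) := fun z => by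
    simp only [hop, mul_left_comm (u z), Finset.mul_sum, mul_add]
  simp only [h1, h2]
  rw [tsum_mul_left, tsum_mul_left, Summable.tsum_finsetSum fun i _ => (e1 _).add (e2 _),
    Summable.tsum_finsetSum fun i _ => (e3 _).add (e4 _)]
  congr 1
  refine Finset.sum_congr rfl fun i _ => ?_
  rw [(e1 _).tsum_add (e2 _), (e3 _).tsum_add (e4 _), s1, s2, add_comm]

theorem tsum_mul_pointMass {d : ℕ} (u : Lattice d → ℝ) (y : Lattice d) :
    ∑' z, u z * pointMass y z = u y := by
  rw [tsum_eq_single y fun z hz => by rw [pointMass_ne hz, mul_zero], pointMass_self, mul_one]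

/-- Pair `G(·,a)` with `G(·,b)` and move the symmetric averaging operator across: the potential
terms cancel and the two point masses remain. -/
theorem green_comm {d : ℕ} (hd : 0 < d) {ε : ℝ} (hε : 0 < ε) {v : Lattice d → ℝ}
    (hv : ∀ z, ε ≤ v z) (a b : Lattice d) : green v a b = green v b a := by
  have h := tsum_hop_mul (green_spec hd hε hv a).2.2.2.2 (abs_green_le hd hε hv b)
  have hδ : ∀ y z : Lattice d, |pointMass y z| ≤ 1 := fun y z => by
    rw [abs_of_nonneg (pointMass_nonneg y z)]; exact pointMass_le y z
  have ha := (green_spec hd hε hv a).2.2.2.2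
  have hb := (green_spec hd hε hv b).2.2.2.2
  have t1 := tsum_mul_pointMass (fun z => green v z b) a
  have t2 := tsum_mul_pointMass (fun z => green v z a) b
  have s1 := summable_mul_of_abs_le hb (hδ a)
  have s2 := summable_mul_of_abs_le ha (hδ b)
  have sh := summable_mul_of_abs_le (summable_hop ha) (abs_green_le hd hε hv b)
  rw [← t1, ← t2]
  have h1 : ∀ z, hop (fun z => green v z a) z * green v z b + green v z b * pointMass a z
      = green v z a * hop (fun z => green v z b) z + green v z a * pointMass b z := by
    intro z
    rw [hop_green hd hε hv, hop_green hd hε hv]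
    ring
  have sh' : Summable fun z => green v z a * hop (fun z => green v z b) z := by
    have := (sh.add s1).sub s2
    refine this.congr fun z => ?_
    linarith [h1 z]
  have h2 := tsum_congr (L := .unconditional _) h1
  rw [sh.tsum_add s1, sh'.tsum_add s2] at h2
  linarith

/-- The difference of the two sides, as a function of `a`, vanishes at `b`, and off `b` its image
under `H` is `G(b,b) δ_c ≥ 0`. The maximum principle applies because it asks for a sign only where
the function is negative. -/
theorem green_mul_green_le {d : ℕ} (hd : 0 < d) {ε : ℝ} (hε : 0 < ε) {v : Lattice d → ℝ}
    (hv : ∀ z, ε ≤ v z) (a b c : Lattice d) :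
    green v a b * green v b c ≤ green v b b * green v a c := by
  have h := nonneg_of_schrodingerExpr_nonneg hd hε
    (u := green v b b • (fun z => green v z c) - green v b c • (fun z => green v z b)) hv
    (B := 1 / ε * (1 / ε)) ?_ ?_ a
  · simp only [Pi.sub_apply, Pi.smul_apply, smul_eq_mul] at h
    linarith
  · intro z
    simp only [Pi.sub_apply, Pi.smul_apply, smul_eq_mul]
    have h1 := mul_nonneg (green_nonneg hd hε hv b b) (green_nonneg hd hε hv z c)
    have h2 := mul_le_mul ((green_spec hd hε hv c).2.2.1 b) ((green_spec hd hε hv b).2.2.1 z)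
      (green_nonneg hd hε hv z b) (by positivity)
    linarith
  · intro z hz
    have hzb : z ≠ b := by
      rintro rfl
      simp only [Pi.sub_apply, Pi.smul_apply, smul_eq_mul] at hz
      linarith
    rw [map_sub, map_smul, map_smul, schrodingerExpr_green hd hε hv, schrodingerExpr_green hd hε hv]
    simp only [Pi.sub_apply, Pi.smul_apply, smul_eq_mul, pointMass_ne hzb, mul_zero, sub_zero]
    exact mul_nonneg (green_nonneg hd hε hv b b) (pointMass_nonneg c z)

theorem le_green_self {d : ℕ} (hd : 0 < d) {ε M : ℝ} (hε : 0 < ε) {v : Lattice d → ℝ}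
    (hv : ∀ z, ε ≤ v z) (hM : ∀ z, v z ≤ M) (y : Lattice d) : 1 / (1 + M) ≤ green v y y := by
  have h := hop_green hd hε hv y y
  have h1 := hop_nonneg (fun z => green_nonneg hd hε hv z y) y
  rw [pointMass_self] at h
  have := hv y
  rw [div_le_iff₀ (by linarith [hM y])]
  nlinarith [hM y, green_nonneg hd hε hv y y]

theorem lattice_induction {d : ℕ} {p : Lattice d → Prop} {x : Lattice d} (hx : p x)
    (hadd : ∀ a i, p a → p (a + Pi.single i 1)) (hsub : ∀ a i, p a → p (a - Pi.single i 1))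
    (a : Lattice d) : p a := by
  have h1 : ∀ (n : ℤ) (a : Lattice d) (i : Fin d), p a → p (a + Pi.single i n) := by
    intro n a i ha
    induction n using Int.induction_on with
    | zero => simpa using ha
    | succ n ih => simpa [Pi.single_add, add_assoc] using hadd _ i ih
    | pred n ih => simpa [Pi.single_sub, add_sub_assoc] using hsub _ i ih
  have h2 : ∀ S : Finset (Fin d), p (x + ∑ i ∈ S, Pi.single i (a i - x i)) := by
    intro S
    induction S using Finset.induction_on with
    | empty => simpa using hx
    | insert i S hi ih =>
      rw [Finset.sum_insert hi, add_left_comm, add_comm]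
      exact h1 _ _ i ih
  have h3 := h2 Finset.univ
  rw [Finset.univ_sum_single (fun i => a i - x i)] at h3
  convert h3 using 1
  funext i
  simp

theorem le_hop_add {d : ℕ} {ψ : Lattice d → ℝ} (h : ∀ z, 0 ≤ ψ z) (a : Lattice d) (i : Fin d) :
    1 / (2 * (d : ℝ)) * (ψ (a + Pi.single i 1) + ψ (a - Pi.single i 1)) ≤ hop ψ a := by
  refine mul_le_mul_of_nonneg_left ?_ (by positivity)
  exact Finset.single_le_sum
    (f := fun i : Fin d => ψ (a + Pi.single i 1) + ψ (a - Pi.single i 1))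
    (fun i _ => add_nonneg (h _) (h _)) (Finset.mem_univ i)

/-- Positivity spreads from the pole, since each neighbour step costs a factor `1 / (2d(1 + M))`.
The constant may depend on `d`, `a` and `x`: it serves positivity and boundedness of `ρ`, never the
final constants. -/
theorem exists_pos_le_green {d : ℕ} (hd : 0 < d) {ε M : ℝ} (hε : 0 < ε) (hM0 : 0 < M)
    (a x : Lattice d) :
    ∃ c : ℝ, 0 < c ∧ ∀ v : Lattice d → ℝ, (∀ z, ε ≤ v z) → (∀ z, v z ≤ M) → c ≤ green v a x := by
  have hd' : (0 : ℝ) < d := by exact_mod_cast hd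
  have step : ∀ (a b : Lattice d) (i : Fin d), (b = a + Pi.single i 1 ∨ b = a - Pi.single i 1) →
      ∀ c : ℝ, 0 < c → (∀ v : Lattice d → ℝ, (∀ z, ε ≤ v z) → (∀ z, v z ≤ M) → c ≤ green v b x) →
      ∃ c : ℝ, 0 < c ∧ ∀ v : Lattice d → ℝ, (∀ z, ε ≤ v z) → (∀ z, v z ≤ M) →
        c ≤ green v a x := by
    intro a b i hab c hc h
    refine ⟨1 / (2 * (d : ℝ)) * c / (1 + M), by positivity, fun v hv hM => ?_⟩
    have h1 := hop_green hd hε hv x a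
    have h2 := le_hop_add (fun z => green_nonneg hd hε hv z x) a i
    have h3 : c ≤ green v (a + Pi.single i 1) x + green v (a - Pi.single i 1) x := by
      have := h v hv hM
      have h5 := green_nonneg hd hε hv (a + Pi.single i 1) x
      have h6 := green_nonneg hd hε hv (a - Pi.single i 1) x
      rcases hab with rfl | rfl <;> linarith
    have h4 : 1 / (2 * (d : ℝ)) * c
        ≤ 1 / (2 * (d : ℝ)) * (green v (a + Pi.single i 1) x + green v (a - Pi.single i 1) x) := by
      gcongr
    rw [div_le_iff₀ (by linarith)]
    nlinarith [pointMass_nonneg x a, hM a, green_nonneg hd hε hv a x]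
  refine lattice_induction (x := x) (p := fun a => ∃ c : ℝ, 0 < c ∧ ∀ v : Lattice d → ℝ,
    (∀ z, ε ≤ v z) → (∀ z, v z ≤ M) → c ≤ green v a x) ?_ ?_ ?_ a
  · exact ⟨1 / (1 + M), by positivity, fun v hv hM => le_green_self hd hε hv hM x⟩
  · rintro a i ⟨c, hc, h⟩
    exact step _ a i (Or.inr (by simp)) c hc h
  · rintro a i ⟨c, hc, h⟩
    exact step _ a i (Or.inl (by simp)) c hc h

theorem green_pos {d : ℕ} (hd : 0 < d) {ε M : ℝ} (hε : 0 < ε) {v : Lattice d → ℝ}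
    (hv : ∀ z, ε ≤ v z) (hM : ∀ z, v z ≤ M) (a x : Lattice d) : 0 < green v a x := by
  obtain ⟨c, hc, h⟩ := exists_pos_le_green hd hε (hε.trans_le ((hv 0).trans (hM 0))) a x
  exact hc.trans_le (h v hv hM)

/-! ### Rank-one perturbation and the effect of one site on `ρ` -/

/-- The second resolvent identity, obtained here because both sides are bounded solutions of the
same equation for `v`. -/
theorem green_update {d : ℕ} (hd : 0 < d) {ε : ℝ} (hε : 0 < ε) {v : Lattice d → ℝ}
    (hv : ∀ z, ε ≤ v z) {y : Lattice d} {s : ℝ} (hs : ε ≤ s) (a b : Lattice d) :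
    green (Function.update v y s) a b
      = green v a b - (s - v y) * green (Function.update v y s) y b * green v a y := by
  set v' := Function.update v y s
  have hv' : ∀ z, ε ≤ v' z := by
    intro z
    by_cases hz : z = y
    · subst hz; simpa [v'] using hs
    · simpa [v', hz] using hv z
  have hexpr : ∀ u z, schrodingerExpr v u z
      = schrodingerExpr v' u z - (s - v y) * u y * pointMass y z := by
    intro u z
    rw [schrodingerExpr_apply, schrodingerExpr_apply]
    by_cases hz : z = y
    · subst hz; simp only [v', Function.update_self, pointMass_self]; ring
    · simp only [v', Function.update_of_ne hz, pointMass_ne hz]; ring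
  have h := eq_of_schrodingerExpr_eq hd hε hv (u := fun z => green v' z b)
    (w := (fun z => green v z b) - ((s - v y) * green v' y b) • (fun z => green v z y))
    (abs_green_le hd hε hv' b) (B' := 1 / ε + |(s - v y) * green v' y b| * (1 / ε)) ?_ ?_
  · exact congrFun h a
  · intro z
    simp only [Pi.sub_apply, Pi.smul_apply, smul_eq_mul]
    refine (abs_sub _ _).trans ?_
    rw [abs_mul ((s - v y) * green v' y b)]
    have h1 := abs_green_le hd hε hv b z
    have h2 := abs_green_le hd hε hv y z
    gcongr
  · funext z
    rw [hexpr, map_sub, map_smul, schrodingerExpr_green hd hε hv', schrodingerExpr_green hd hε hv,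
      schrodingerExpr_green hd hε hv]
    simp

theorem abs_log_sub_log_le {r X Y : ℝ} (hr : 0 < r) (hX : r ≤ X) (hY : r ≤ Y) :
    |Real.log X - Real.log Y| ≤ |X - Y| / r := by
  have key : ∀ {X Y : ℝ}, r ≤ X → r ≤ Y → Real.log X - Real.log Y ≤ |X - Y| / r := by
    intro X Y hX hY
    have hX0 := hr.trans_le hX
    have hY0 := hr.trans_le hY
    rw [← Real.log_div hX0.ne' hY0.ne']
    refine (Real.log_le_sub_one_of_pos (by positivity)).trans ?_
    rw [show X / Y - 1 = (X - Y) / Y by field_simp]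
    calc (X - Y) / Y ≤ |X - Y| / Y := by gcongr; exact le_abs_self _
      _ ≤ |X - Y| / r := by gcongr
  rw [abs_le]
  constructor
  · have := key hY hX
    rw [abs_sub_comm] at this
    linarith
  · exact key hX hY

theorem rho_eq {d : ℕ} {v : Lattice d → ℝ} {x y : Lattice d} (h1 : 0 < green v x x)
    (h2 : 0 < green v y y) (h3 : 0 < green v x y) :
    rho v x y = (Real.log (green v x x) + Real.log (green v y y)) / 2
      - Real.log (green v x y) := by
  rw [rho, Real.log_div (by positivity) h3.ne', Real.log_sqrt (by positivity),
    Real.log_mul h1.ne' h2.ne']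

/-- The influence of the potential at `y` on `-log G(o, x)`. -/
noncomputable def influence {d : ℕ} (v : Lattice d → ℝ) (o x y : Lattice d) : ℝ :=
  green v o y * green v y x / green v o x

theorem influence_le {d : ℕ} (hd : 0 < d) {ε M : ℝ} (hε : 0 < ε) {v : Lattice d → ℝ}
    (hv : ∀ z, ε ≤ v z) (hM : ∀ z, v z ≤ M) (o x y : Lattice d) :
    influence v o x y ≤ green v y y := by
  rw [influence, div_le_iff₀ (green_pos hd hε hv hM o x)]
  exact green_mul_green_le hd hε hv o y x

theorem influence_nonneg {d : ℕ} (hd : 0 < d) {ε : ℝ} (hε : 0 < ε) {v : Lattice d → ℝ}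
    (hv : ∀ z, ε ≤ v z) (o x y : Lattice d) : 0 ≤ influence v o x y :=
  div_nonneg (mul_nonneg (green_nonneg hd hε hv _ _) (green_nonneg hd hε hv _ _))
    (green_nonneg hd hε hv _ _)

/-- The change of `ρ` is the mean, over the endpoints `c = o, x`, of `log(1 - κ a_c) - log(1 - κ
b)`. Here `b` is the influence on `G(o,x)` and `a_c` the influence on `G(c,c)`, with `0 ≤ a_c ≤ b`.
-/
theorem abs_rho_update_sub_le {d : ℕ} (hd : 0 < d) {ε M : ℝ} (hε : 0 < ε) {v : Lattice d → ℝ}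
    (hv : ∀ z, ε ≤ v z) (hM : ∀ z, v z ≤ M) {y : Lattice d} {s : ℝ} (hs : ε ≤ s) (hsM : s ≤ M)
    (o x : Lattice d) :
    |rho (Function.update v y s) o x - rho v o x|
      ≤ M * ((1 + M) / ε) ^ 2 * influence v o x y := by
  set v' := Function.update v y s
  have hv' : ∀ z, ε ≤ v' z := by
    intro z
    by_cases hz : z = y
    · subst hz; simpa [v'] using hs
    · simpa [v', hz] using hv z
  have hM' : ∀ z, v' z ≤ M := by
    intro z
    by_cases hz : z = y
    · subst hz; simpa [v'] using hsM
    · simpa [v', hz] using hM z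
  have hpos := green_pos hd hε hv hM
  have hpos' := green_pos hd hε hv' hM'
  have hup : ∀ a b, green v' a b = green v a b - (s - v y) * green v' y b * green v a y :=
    green_update hd hε hv hs
  have hM0 : 0 < M := hε.trans_le (hs.trans hsM)
  -- With this `κ`, the new Green function drops out of the right side of the resolvent identity
  -- except through a scalar, giving `hup2`.
  set κ := (s - v y) * green v' y y / green v y y with hκ
  have hup2 : ∀ a b, green v' a b = green v a b - κ * (green v a y * green v y b) := by
    intro a b
    have e1 := hup y b
    have e2 := hup y y
    have e3 : green v' y b * green v y y = green v' y y * green v y b := by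
      linear_combination green v' y y * e1 - green v' y b * e2
    have e4 : (s - v y) * green v' y b = κ * green v y b := by
      have := (hpos y y).ne'
      rw [hκ]; field_simp
      linear_combination (s - v y) * e3
    rw [hup a b, e4]; ring
  -- At `a = G(y,y)` the factor `1 - κ a` equals `G'(y,y) / G(y,y)`, a ratio of a quantity at least
  -- `1 / (1 + M)` to one at most `1/ε`. Being affine in `a` and equal to `1` at `0`, it stays above
  -- `r` in between, so the logarithm is Lipschitz there.
  set r := ε / (1 + M) with hr
  have hr0 : 0 < r := by positivity
  have hr1 : r ≤ 1 := by
    rw [hr, div_le_one (by positivity)]; linarith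
  have hry : r ≤ 1 - κ * green v y y := by
    have e : 1 - κ * green v y y = green v' y y / green v y y := by
      rw [eq_div_iff (hpos y y).ne', hup2 y y]; ring
    rw [e, le_div_iff₀ (hpos y y)]
    calc r * green v y y ≤ r * (1 / ε) := by gcongr; exact (green_spec hd hε hv y).2.2.1 y
      _ = 1 / (1 + M) := by rw [hr]; field_simp
      _ ≤ _ := le_green_self hd hε hv' hM' y
  have hκ0 : |κ| ≤ M * ((1 + M) / ε) := by
    rw [hκ, abs_div, abs_mul, abs_of_pos (hpos y y), abs_of_pos (hpos' y y), div_le_iff₀ (hpos y y)]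
    have h1 : |s - v y| ≤ M := by rw [abs_le]; constructor <;> linarith [hv y, hM y]
    have h2 := le_green_self hd hε hv hM y
    calc |s - v y| * green v' y y ≤ M * (1 / ε) :=
          mul_le_mul h1 ((green_spec hd hε hv' y).2.2.1 y) (hpos' y y).le hM0.le
      _ = M * ((1 + M) / ε) * (1 / (1 + M)) := by field_simp
      _ ≤ _ := by gcongr
  have hb0 := influence_nonneg hd hε hv o x y
  have hby := influence_le hd hε hv hM o x y
  set b := influence v o x y with hb
  have hrange : ∀ a, 0 ≤ a → a ≤ green v y y → r ≤ 1 - κ * a := by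
    intro a h0 h1
    rcases le_total κ 0 with h | h <;> nlinarith
  have hgen : ∀ c, green v c y * green v y c / green v c c ≤ b →
      Real.log (green v' c c) - Real.log (green v c c)
        = Real.log (1 - κ * (green v c y * green v y c / green v c c)) ∧
      |Real.log (1 - κ * (green v c y * green v y c / green v c c)) - Real.log (1 - κ * b)|
        ≤ M * ((1 + M) / ε) ^ 2 * b := by
    intro c hc
    have h0 : 0 ≤ green v c y * green v y c / green v c c :=
      (div_pos (mul_pos (hpos _ _) (hpos _ _)) (hpos _ _)).le
    constructor
    · rw [← Real.log_div (hpos' c c).ne' (hpos c c).ne']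
      congr 1
      have := (hpos c c).ne'
      rw [hup2 c c]; field_simp
    · refine (abs_log_sub_log_le hr0 (hrange _ h0 (hc.trans hby)) (hrange _ hb0 hby)).trans ?_
      set a := green v c y * green v y c / green v c c
      rw [show 1 - κ * a - (1 - κ * b) = κ * (b - a) by ring, abs_mul,
        abs_of_nonneg (sub_nonneg.2 hc), div_le_iff₀ hr0]
      calc |κ| * (b - a) ≤ M * ((1 + M) / ε) * b := by gcongr; linarith
        _ = M * ((1 + M) / ε) ^ 2 * b * r := by rw [hr]; field_simp
  have hox : Real.log (green v' o x) - Real.log (green v o x) = Real.log (1 - κ * b) := by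
    rw [← Real.log_div (hpos' o x).ne' (hpos o x).ne']
    congr 1
    have := (hpos o x).ne'
    rw [hup2 o x, hb, influence]; field_simp
  have hso := hgen o (by
    rw [hb, influence, div_le_div_iff₀ (hpos o o) (hpos o x), mul_assoc, mul_assoc]
    refine mul_le_mul_of_nonneg_left ?_ (hpos o y).le
    rw [mul_comm (green v y x)]
    exact green_mul_green_le hd hε hv y o x)
  have hsx := hgen x (by
    rw [hb, influence, div_le_div_iff₀ (hpos x x) (hpos o x), green_comm hd hε hv x y]
    have := green_mul_green_le hd hε hv o x y
    rw [green_comm hd hε hv x y] at this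
    nlinarith [hpos y x])
  rw [rho_eq (hpos o o) (hpos x x) (hpos o x), rho_eq (hpos' o o) (hpos' x x) (hpos' o x)]
  have e1 := abs_le.1 hso.2
  have e2 := abs_le.1 hsx.2
  rw [abs_le]
  constructor <;> linarith [hso.1, hsx.1]

theorem rho_nonneg {d : ℕ} (hd : 0 < d) {ε M : ℝ} (hε : 0 < ε) {v : Lattice d → ℝ}
    (hv : ∀ z, ε ≤ v z) (hM : ∀ z, v z ≤ M) (o x : Lattice d) : 0 ≤ rho v o x := by
  have h := green_mul_green_le hd hε hv x o x
  rw [green_comm hd hε hv x o] at h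
  refine Real.log_nonneg ?_
  rw [le_div_iff₀ (green_pos hd hε hv hM o x), one_mul]
  exact Real.le_sqrt_of_sq_le (by nlinarith)

theorem neg_log_green_le {d : ℕ} (hd : 0 < d) {ε M : ℝ} (hε : 0 < ε) {v : Lattice d → ℝ}
    (hv : ∀ z, ε ≤ v z) (hM : ∀ z, v z ≤ M) (o x : Lattice d) :
    -Real.log (green v o x) ≤ rho v o x + Real.log (1 + M) := by
  have hM0 : 0 < M := hε.trans_le ((hv 0).trans (hM 0))
  have hpos := green_pos hd hε hv hM
  rw [rho_eq (hpos o o) (hpos x x) (hpos o x)]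
  have h : ∀ y, -Real.log (1 + M) ≤ Real.log (green v y y) := fun y => by
    rw [← Real.log_inv]
    exact Real.log_le_log (by positivity) (by simpa using le_green_self hd hε hv hM y)
  linarith [h o, h x]

/-- Only the existence of a bound uniform in `v` matters: it gives integrability and dominated
convergence. -/
theorem rho_le {d : ℕ} (hd : 0 < d) {ε M : ℝ} (hε : 0 < ε) (hM0 : 0 < M) (o x : Lattice d) :
    ∃ A : ℝ, ∀ v : Lattice d → ℝ, (∀ z, ε ≤ v z) → (∀ z, v z ≤ M) → rho v o x ≤ A := by
  obtain ⟨c, hc, h⟩ := exists_pos_le_green hd hε hM0 o x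
  refine ⟨-Real.log ε - Real.log c, fun v hv hM => ?_⟩
  have hpos := green_pos hd hε hv hM
  rw [rho_eq (hpos o o) (hpos x x) (hpos o x)]
  have h1 : ∀ y, Real.log (green v y y) ≤ -Real.log ε := fun y => by
    rw [← Real.log_inv]
    exact Real.log_le_log (hpos y y) (by simpa using (green_spec hd hε hv y).2.2.1 y)
  linarith [h1 o, h1 x, Real.log_le_log hc (h v hv hM)]

/-! ### Convexity in the energy and the sum of the influences -/

/-- Jacobi iterates for `G² δ_y`. -/
noncomputable def greenSqIter {d : ℕ} (v : Lattice d → ℝ) (y : Lattice d) : ℕ → Lattice d → ℝ :=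
  -- The shift to `k + 1` makes stage `k` a sum over the same lattice paths as stage `k` of
  -- `greenIter`, each path weighted additionally by the sum of `1 / (1 + v)` over its sites.
  jacobi v fun k => greenIter v y (k + 1)

/-- Log-convexity of the Green function in the energy, in tangent-line form, for iterates. -/
theorem tangent_le_greenIter {d : ℕ} {v : Lattice d → ℝ} {s : ℝ} (hs : 0 ≤ s)
    (hv : ∀ z, s < v z) (y : Lattice d) (k : ℕ) (c : ℝ) (a : Lattice d) :
    Real.exp c * ((1 - c) * greenIter v y k a + s * greenSqIter v y k a)
      ≤ greenIter (fun z => v z - s) y k a := by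
  induction k generalizing c a with
  | zero => simp [greenIter, greenSqIter, jacobi]
  | succ k ih =>
    have hva := hv a
    have hD : 0 < 1 + v a := by linarith
    -- Lowering `v` by `s` multiplies a path's weight by at least `e^T`, where `T` sums `s / (1 +
    -- v)` along the path, and `e^T ≥ e^c (1 - c + T)`. Removing the first site `a` lowers `T` by `s
    -- / (1 + v a)`, so the tangent point moves by the same amount; this is why the induction is
    -- over all `c`.
    set c' := c - s / (1 + v a) with hc'
    set gh := greenIter (fun z => v z - s) y k with hgh
    have hgh0 : ∀ z, 0 ≤ gh z := jacobi_nonneg (fun z => by linarith [hv z])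
      (fun _ => pointMass_nonneg y) k
    have h1 := hop_mono (ih c') a
    rw [hop_const_mul, hop_add, hop_const_mul, hop_const_mul] at h1
    have h2 : Real.exp c' * ((1 - c') * pointMass y a) ≤ pointMass y a := by
      have e1 : 1 - c' ≤ Real.exp (-c') := by linarith [Real.add_one_le_exp (-c')]
      have e2 : Real.exp c' * (1 - c') ≤ 1 := by
        calc Real.exp c' * (1 - c') ≤ Real.exp c' * Real.exp (-c') := by gcongr
          _ = 1 := by rw [← Real.exp_add]; simp
      nlinarith [pointMass_nonneg y a]
    have e3 : (1 + v a - s) * Real.exp (s / (1 + v a)) ≤ 1 + v a := by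
      have : 1 - s / (1 + v a) ≤ Real.exp (-(s / (1 + v a))) := by
        linarith [Real.add_one_le_exp (-(s / (1 + v a)))]
      have h5 : 1 + v a - s = (1 + v a) * (1 - s / (1 + v a)) := by field_simp
      calc (1 + v a - s) * Real.exp (s / (1 + v a))
          ≤ ((1 + v a) * Real.exp (-(s / (1 + v a)))) * Real.exp (s / (1 + v a)) := by
            rw [h5]; gcongr
        _ = 1 + v a := by rw [mul_assoc, ← Real.exp_add]; simp
    have hexp : Real.exp c = Real.exp (s / (1 + v a)) * Real.exp c' := by
      rw [← Real.exp_add]; congr 1; rw [hc']; ring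
    have hg : (1 + v a) * greenIter v y (k + 1) a = hop (greenIter v y k) a + pointMass y a := by
      rw [greenIter, jacobi_succ]; field_simp
    have hh : (1 + v a) * greenSqIter v y (k + 1) a
        = hop (greenSqIter v y k) a + greenIter v y (k + 1) a := by
      rw [greenSqIter, jacobi_succ]; field_simp
    set g1 := greenIter v y (k + 1) a
    set q1 := greenSqIter v y (k + 1) a
    have hR : greenIter (fun z => v z - s) y (k + 1) a
        = (hop gh a + pointMass y a) / (1 + v a - s) := by
      rw [greenIter, jacobi_succ]
      congr 1
      ring
    rw [hR, le_div_iff₀ (by linarith)]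
    set G := hop (greenIter v y k) a
    set Q := hop (greenSqIter v y k) a
    set E' := Real.exp c'
    set E := Real.exp (s / (1 + v a))
    have hE : 0 < E := Real.exp_pos _
    have hX : 0 ≤ hop gh a + pointMass y a := add_nonneg (hop_nonneg hgh0 a) (pointMass_nonneg y a)
    have key : (1 + v a) * ((1 - c) * g1 + s * q1)
        = (1 - c') * G + s * Q + (1 - c') * pointMass y a := by
      have : (1 - c') * (1 + v a) = (1 - c) * (1 + v a) + s := by
        rw [hc']; field_simp; ring
      linear_combination (1 - c') * hg + s * hh - g1 * this
    have hmain : E' * ((1 + v a) * ((1 - c) * g1 + s * q1)) ≤ hop gh a + pointMass y a := by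
      rw [key]; linarith
    have : (1 + v a) * (Real.exp c * ((1 - c) * g1 + s * q1) * (1 + v a - s))
        ≤ (1 + v a) * (hop gh a + pointMass y a) := by
      calc (1 + v a) * (Real.exp c * ((1 - c) * g1 + s * q1) * (1 + v a - s))
          = ((1 + v a - s) * E) * (E' * ((1 + v a) * ((1 - c) * g1 + s * q1))) := by
            rw [hexp]; ring
        _ ≤ ((1 + v a - s) * E) * (hop gh a + pointMass y a) := by
            refine mul_le_mul_of_nonneg_left hmain (mul_nonneg (by linarith) hE.le)
        _ ≤ _ := mul_le_mul_of_nonneg_right e3 hX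
    exact le_of_mul_le_mul_left this hD

theorem schrodingerExpr_finsetSum_green {d : ℕ} (hd : 0 < d) {ε : ℝ} (hε : 0 < ε)
    {v : Lattice d → ℝ} (hv : ∀ z, ε ≤ v z) (S : Finset (Lattice d)) (c : Lattice d → ℝ)
    (a : Lattice d) :
    schrodingerExpr v (fun z => ∑ y ∈ S, green v z y * c y) a = ∑ y ∈ S, pointMass y a * c y := by
  have : (fun z => ∑ y ∈ S, green v z y * c y) = ∑ y ∈ S, c y • fun z => green v z y := by
    funext z
    simp [Finset.sum_apply, mul_comm]
  rw [this, map_sum, Finset.sum_apply]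
  refine Finset.sum_congr rfl fun y _ => ?_
  rw [map_smul, schrodingerExpr_green hd hε hv]
  simp [mul_comm]

/-- This is the tangent inequality at shift `s = ε/2`, in the limit of the iterates: the lowered
potential is still at least `ε/2`, so its Green function is at most `2/ε`. -/
theorem exp_mul_green_le {d : ℕ} (hd : 0 < d) {ε : ℝ} (hε : 0 < ε) {v : Lattice d → ℝ}
    (hv : ∀ z, ε ≤ v z) (o x : Lattice d) (S : Finset (Lattice d)) (c : ℝ) :
    Real.exp c * ((1 - c) * green v o x + ε / 2 * ∑ y ∈ S, green v o y * green v y x)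
      ≤ 2 / ε := by
  have hv0 : ∀ z, 0 < v z := fun z => hε.trans_le (hv z)
  have hv2 : ∀ z, ε / 2 ≤ v z - ε / 2 := fun z => by linarith [hv z]
  have hg0 : ∀ k z, 0 ≤ greenIter v x k z := jacobi_nonneg hv0 fun _ => pointMass_nonneg x
  have hg1 : ∀ k z, greenIter v x k z ≤ 1 / ε :=
    jacobi_le hd hε hv zero_le_one fun _ => pointMass_le x
  have hgm : ∀ k z, greenIter v x k z ≤ greenIter v x (k + 1) z :=
    jacobi_mono hv0 (fun _ => pointMass_nonneg x) fun _ _ => le_rfl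
  have hlim := (green_spec hd hε hv x).1
  obtain ⟨h, hh1, hh2, hh3, hh4⟩ := exists_tendsto_jacobi hd hε hv
    (f := fun k => greenIter v x (k + 1)) (B := 1 / ε)
    (fun k => hg0 (k + 1)) (fun k => hg1 (k + 1)) (fun k => hgm (k + 1))
    (fun z => (hlim z).comp (Filter.tendsto_add_atTop_nat 1))
  -- Comparison suffices: `H` maps the partial sum to `G(·,x)` restricted to `S`, which lies below
  -- `H h = G(·,x)`.
  have hle : ∑ y ∈ S, green v o y * green v y x ≤ h o := by
    refine le_of_schrodingerExpr_le hd hε (u := fun z => ∑ y ∈ S, green v z y * green v y x)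
      hv (B := ∑ y ∈ S, 1 / ε * (1 / ε)) (B' := 1 / ε / ε) ?_ ?_ ?_ o
    · intro z
      refine (Finset.abs_sum_le_sum_abs _ _).trans (Finset.sum_le_sum fun y _ => ?_)
      rw [abs_mul]
      exact mul_le_mul (abs_green_le hd hε hv _ _) (abs_green_le hd hε hv _ _) (abs_nonneg _)
        (by positivity)
    · intro z
      rw [abs_of_nonneg (hh2 z)]; exact hh3 z
    · intro z
      rw [schrodingerExpr_finsetSum_green hd hε hv, hh4]
      by_cases hz : z ∈ S
      · rw [Finset.sum_eq_single z (fun y _ hy => by rw [pointMass_ne hy.symm, zero_mul])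
          (fun hz' => absurd hz hz'), pointMass_self, one_mul]
      · rw [Finset.sum_eq_zero fun y hy => by
          rw [pointMass_ne (ne_of_mem_of_not_mem hy hz).symm, zero_mul]]
        exact green_nonneg hd hε hv z x
  have hk : ∀ k, Real.exp c * ((1 - c) * greenIter v x k o + ε / 2 * greenSqIter v x k o)
      ≤ 2 / ε := fun k => by
    refine (tangent_le_greenIter (by positivity) (fun z => by linarith [hv z]) x k c o).trans ?_
    have := jacobi_le hd (half_pos hε) hv2 zero_le_one (fun _ => pointMass_le x) k o
    rwa [one_div_div] at this
  have hlim2 := ((((hlim o).const_mul (1 - c)).add ((hh1 o).const_mul (ε / 2))).const_mul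
    (Real.exp c))
  refine le_trans ?_ (le_of_tendsto' hlim2 hk)
  gcongr

theorem sum_influence_le {d : ℕ} (hd : 0 < d) {ε M : ℝ} (hε : 0 < ε) {v : Lattice d → ℝ}
    (hv : ∀ z, ε ≤ v z) (hM : ∀ z, v z ≤ M) (o x : Lattice d) (S : Finset (Lattice d)) :
    ∑ y ∈ S, influence v o x y ≤ 2 / ε * (rho v o x + (Real.log (1 + M) + Real.log (2 / ε))) := by
  have hg := green_pos hd hε hv hM o x
  set I := ∑ y ∈ S, influence v o x y with hI
  have hIg : ∑ y ∈ S, green v o y * green v y x = I * green v o x := by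
    rw [hI, Finset.sum_mul]
    refine Finset.sum_congr rfl fun y _ => ?_
    rw [influence]; field_simp
  -- The tangent point `c = (ε/2) I` makes the bracket collapse to `G(o,x)`, leaving `e^{(ε/2) I}
  -- G(o,x) ≤ 2/ε`.
  have h := exp_mul_green_le hd hε hv o x S (ε / 2 * I)
  rw [hIg, show (1 - ε / 2 * I) * green v o x + ε / 2 * (I * green v o x) = green v o x by ring]
    at h
  have h2 := Real.log_le_log (by positivity) h
  rw [Real.log_mul (by positivity) hg.ne', Real.log_exp] at h2
  have h3 := neg_log_green_le hd hε hv hM o x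
  calc I = 2 / ε * (ε / 2 * I) := by field_simp
    _ ≤ _ := by gcongr; linarith

/-- The self-bounding property: a squared influence is at most `1/ε` times the influence, and the
influences sum to `O(ρ + 1)`. The bound `b` does not depend on the new value `s`. -/
theorem sum_sq_rho_update_sub_le {d : ℕ} (hd : 0 < d) {ε M : ℝ} (hε : 0 < ε)
    {v : Lattice d → ℝ} (hv : ∀ z, ε ≤ v z) (hM : ∀ z, v z ≤ M) (o x : Lattice d) :
    ∃ b : Lattice d → ℝ, (∀ y s, ε ≤ s → s ≤ M →
        (rho v o x - rho (Function.update v y s) o x) ^ 2 ≤ b y) ∧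
      ∀ S : Finset (Lattice d), ∑ y ∈ S, b y ≤
        (M * ((1 + M) / ε) ^ 2) ^ 2 * (2 / ε ^ 2) * (1 + Real.log (1 + M) + |Real.log (2 / ε)|)
          * (rho v o x + 1) := by
  have hM0 : 0 < M := hε.trans_le ((hv 0).trans (hM 0))
  set K := M * ((1 + M) / ε) ^ 2 with hK
  have hinf0 := influence_nonneg hd hε hv o x
  have hinf1 : ∀ y, influence v o x y ≤ 1 / ε := fun y =>
    (influence_le hd hε hv hM o x y).trans ((green_spec hd hε hv y).2.2.1 y)
  refine ⟨fun y => K ^ 2 * (1 / ε) * influence v o x y, fun y s hs hsM => ?_, fun S => ?_⟩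
  · have h := abs_rho_update_sub_le hd hε hv hM (y := y) hs hsM o x
    rw [abs_sub_comm] at h
    calc _ = |rho v o x - rho (Function.update v y s) o x| ^ 2 := (sq_abs _).symm
      _ ≤ (K * influence v o x y) ^ 2 := by gcongr
      _ = K ^ 2 * (influence v o x y * influence v o x y) := by ring
      _ ≤ K ^ 2 * (1 / ε * influence v o x y) := by
        have := hinf0 y
        gcongr
        exact hinf1 y
      _ = _ := by ring
  · rw [← Finset.mul_sum]
    have h1 := sum_influence_le hd hε hv hM o x S
    have hr := rho_nonneg hd hε hv hM o x
    have hl : 0 ≤ Real.log (1 + M) := Real.log_nonneg (by linarith)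
    have ha := le_abs_self (Real.log (2 / ε))
    have ha0 := abs_nonneg (Real.log (2 / ε))
    have h2 : rho v o x + (Real.log (1 + M) + Real.log (2 / ε))
        ≤ (1 + Real.log (1 + M) + |Real.log (2 / ε)|) * (rho v o x + 1) := by nlinarith
    calc _ ≤ K ^ 2 * (1 / ε) * (2 / ε * ((1 + Real.log (1 + M) + |Real.log (2 / ε)|)
          * (rho v o x + 1))) := by
          gcongr
          exact h1.trans (by gcongr)
      _ = _ := by ring

/-! ### Continuity in the potential -/

theorem continuousOn_greenIter {d : ℕ} {ε : ℝ} (hε : 0 < ε) (y : Lattice d) (k : ℕ)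
    (a : Lattice d) :
    ContinuousOn (fun v : Lattice d → ℝ => greenIter v y k a) {v | ∀ z, ε ≤ v z} := by
  induction k generalizing a with
  | zero => exact continuousOn_const
  | succ k ih =>
    refine ContinuousOn.div ?_ (by fun_prop) fun v hv => by linarith [hv a]
    refine ContinuousOn.add ?_ continuousOn_const
    exact continuousOn_const.mul (continuousOn_finsetSum _ fun i _ => (ih _).add (ih _))

theorem green_sub_greenIter_le {d : ℕ} (hd : 0 < d) {ε : ℝ} (hε : 0 < ε) {v : Lattice d → ℝ}
    (hv : ∀ z, ε ≤ v z) (y : Lattice d) (k : ℕ) (a : Lattice d) :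
    |green v a y - greenIter v y k a| ≤ 1 / ε * (1 / (1 + ε)) ^ k := by
  induction k generalizing a with
  | zero => simpa [greenIter, jacobi] using abs_green_le hd hε hv y a
  | succ k ih =>
    have hva := hv a
    have e : green v a y - greenIter v y (k + 1) a
        = hop (fun z => green v z y + -1 * greenIter v y k z) a / (1 + v a) := by
      have hne : 1 + v a ≠ 0 := by linarith
      rw [hop_add, hop_const_mul, hop_green hd hε hv, greenIter, jacobi_succ]
      field_simp
      ring
    rw [e, abs_div, abs_of_pos (show 0 < 1 + v a by linarith), div_le_iff₀ (by linarith)]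
    have h1 : ∀ z, |green v z y + -1 * greenIter v y k z| ≤ 1 / ε * (1 / (1 + ε)) ^ k := by
      intro z
      rw [neg_one_mul, ← sub_eq_add_neg]
      exact ih z
    have h2 := abs_le.2 ⟨le_hop hd (fun z => (abs_le.1 (h1 z)).1) a,
      hop_le hd (fun z => (abs_le.1 (h1 z)).2) a⟩
    calc _ ≤ 1 / ε * (1 / (1 + ε)) ^ k := h2
      _ = 1 / ε * (1 / (1 + ε)) ^ (k + 1) * (1 + ε) := by rw [pow_succ]; field_simp
      _ ≤ _ := by gcongr

/-- Continuity is for the product topology: each iterate involves finitely many sites, and the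
iteration contracts by `1 / (1 + ε)` uniformly in `v`. -/
theorem continuousOn_green {d : ℕ} (hd : 0 < d) {ε : ℝ} (hε : 0 < ε) (a y : Lattice d) :
    ContinuousOn (fun v : Lattice d → ℝ => green v a y) {v | ∀ z, ε ≤ v z} := by
  refine TendstoUniformlyOn.continuousOn (F := fun k v => greenIter v y k a) (p := Filter.atTop)
    ?_ (Filter.Eventually.of_forall fun k => continuousOn_greenIter hε y k a).frequently
  rw [Metric.tendstoUniformlyOn_iff]
  intro δ hδ
  have hlim : Filter.Tendsto (fun k : ℕ => 1 / ε * (1 / (1 + ε)) ^ k) Filter.atTop (nhds 0) := by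
    simpa using (tendsto_pow_atTop_nhds_zero_of_lt_one (r := 1 / (1 + ε)) (by positivity)
      ((div_lt_one (by positivity)).2 (by linarith))).const_mul (1 / ε)
  filter_upwards [hlim.eventually (gt_mem_nhds hδ)] with k hk v hv
  exact (green_sub_greenIter_le hd hε hv y k a).trans_lt hk

theorem continuousOn_rho {d : ℕ} (hd : 0 < d) {ε M : ℝ} (hε : 0 < ε) (o x : Lattice d) :
    ContinuousOn (fun v : Lattice d → ℝ => rho v o x) {v | ∀ z, ε ≤ v z ∧ v z ≤ M} := by
  have hG : ∀ a b : Lattice d,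
      ContinuousOn (fun v : Lattice d → ℝ => green v a b) {v | ∀ z, ε ≤ v z ∧ v z ≤ M} :=
    fun a b => (continuousOn_green hd hε a b).mono fun v hv z => (hv z).1
  have hpos : ∀ v ∈ {v : Lattice d → ℝ | ∀ z, ε ≤ v z ∧ v z ≤ M}, ∀ a b, 0 < green v a b :=
    fun v hv => green_pos hd hε (fun z => (hv z).1) (fun z => (hv z).2)
  refine ContinuousOn.log (((hG o o).mul (hG x x)).sqrt.div (hG o x)
    fun v hv => (hpos v hv o x).ne') fun v hv => ?_
  exact (div_pos (Real.sqrt_pos.2 (mul_pos (hpos v hv o o) (hpos v hv x x)))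
    (hpos v hv o x)).ne'

/-! ### Bounded measurable functions -/

/-- Bounded measurable real functions. -/
structure BoundedMeasurable {α : Type*} [MeasurableSpace α] (f : α → ℝ) : Prop where
  measurable : Measurable f
  bounded : ∃ B, ∀ x, |f x| ≤ B

namespace BoundedMeasurable

variable {α β : Type*} [MeasurableSpace α] [MeasurableSpace β] {f g : α → ℝ}

theorem integrable (hf : BoundedMeasurable f) (μ : Measure α) [IsFiniteMeasure μ] :
    Integrable f μ := by
  obtain ⟨B, hB⟩ := hf.bounded
  exact Integrable.of_bound hf.measurable.aestronglyMeasurable B (Filter.Eventually.of_forall hB)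

theorem const (c : ℝ) : BoundedMeasurable fun _ : α => c :=
  ⟨measurable_const, |c|, fun _ => le_rfl⟩

theorem add (hf : BoundedMeasurable f) (hg : BoundedMeasurable g) :
    BoundedMeasurable fun x => f x + g x := by
  obtain ⟨B, hB⟩ := hf.bounded
  obtain ⟨C, hC⟩ := hg.bounded
  exact ⟨hf.measurable.add hg.measurable, B + C,
    fun x => (abs_add_le _ _).trans (add_le_add (hB x) (hC x))⟩

theorem mul (hf : BoundedMeasurable f) (hg : BoundedMeasurable g) :
    BoundedMeasurable fun x => f x * g x := by
  obtain ⟨B, hB⟩ := hf.bounded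
  obtain ⟨C, hC⟩ := hg.bounded
  refine ⟨hf.measurable.mul hg.measurable, B * C, fun x => ?_⟩
  rw [abs_mul]
  exact mul_le_mul (hB x) (hC x) (abs_nonneg _) ((abs_nonneg _).trans (hB x))

theorem sub (hf : BoundedMeasurable f) (hg : BoundedMeasurable g) :
    BoundedMeasurable fun x => f x - g x := by
  simpa [sub_eq_add_neg] using hf.add ((const (-1)).mul hg)

theorem pow_two (hf : BoundedMeasurable f) : BoundedMeasurable fun x => f x ^ 2 := by
  simpa [sq] using hf.mul hf

theorem exp (hf : BoundedMeasurable f) : BoundedMeasurable fun x => Real.exp (f x) := by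
  obtain ⟨B, hB⟩ := hf.bounded
  refine ⟨hf.measurable.exp, Real.exp B, fun x => ?_⟩
  rw [abs_of_pos (Real.exp_pos _)]
  exact Real.exp_le_exp.2 ((le_abs_self _).trans (hB x))

theorem comp (hf : BoundedMeasurable f) {φ : β → α} (hφ : Measurable φ) :
    BoundedMeasurable fun y => f (φ y) := by
  obtain ⟨B, hB⟩ := hf.bounded
  exact ⟨hf.measurable.comp hφ, B, fun y => hB _⟩

theorem integral_snd {F : α × β → ℝ} (hF : BoundedMeasurable F) (ν : Measure β)
    [IsProbabilityMeasure ν] : BoundedMeasurable fun x => ∫ y, F (x, y) ∂ν := by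
  obtain ⟨B, hB⟩ := hF.bounded
  refine ⟨(hF.measurable.stronglyMeasurable.integral_prod_right' (ν := ν)).measurable, B,
    fun x => ?_⟩
  have := norm_integral_le_of_norm_le_const (μ := ν) (f := fun y => F (x, y)) (C := B)
    (Filter.Eventually.of_forall fun y => hB (x, y))
  simpa using this

theorem log_integral_exp (hf : BoundedMeasurable f) (μ : Measure α) [IsProbabilityMeasure μ]
    {B : ℝ} (hB : ∀ x, |f x| ≤ B) : |Real.log (∫ x, Real.exp (f x) ∂μ)| ≤ B := by
  have h1 : Real.exp (-B) ≤ ∫ x, Real.exp (f x) ∂μ := by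
    have := integral_mono ((const (Real.exp (-B))).integrable μ) (hf.exp.integrable μ)
      fun x => Real.exp_le_exp.2 (abs_le.1 (hB x)).1
    simpa using this
  have h2 : ∫ x, Real.exp (f x) ∂μ ≤ Real.exp B := by
    have := integral_mono (hf.exp.integrable μ) ((const (Real.exp B)).integrable μ)
      fun x => Real.exp_le_exp.2 (abs_le.1 (hB x)).2
    simpa using this
  have h0 := (Real.exp_pos _).trans_le h1
  exact abs_le.2 ⟨(Real.le_log_iff_exp_le h0).2 h1, (Real.log_le_iff_le_exp h0).2 h2⟩

theorem integral_exp_pos (hf : BoundedMeasurable f) (μ : Measure α) [IsProbabilityMeasure μ] :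
    0 < ∫ x, Real.exp (f x) ∂μ := MeasureTheory.integral_exp_pos (hf.exp.integrable μ)

end BoundedMeasurable

/-! ### Entropy: duality, one-coordinate inequality, tensorization -/

/-- The entropy of `exp g`. -/
noncomputable def entropyExp {α : Type*} [MeasurableSpace α] (μ : Measure α) (g : α → ℝ) : ℝ :=
  ∫ x, g x * Real.exp (g x) ∂μ - (∫ x, Real.exp (g x) ∂μ) * Real.log (∫ x, Real.exp (g x) ∂μ)

section

variable {α β : Type*} [MeasurableSpace α] [MeasurableSpace β]

/-- The Gibbs variational inequality. -/
theorem integral_exp_mul_le_entropyExp (μ : Measure α) [IsProbabilityMeasure μ] {g h : α → ℝ}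
    (hg : BoundedMeasurable g) (hh : BoundedMeasurable h) (h1 : ∫ x, Real.exp (h x) ∂μ = 1) :
    ∫ x, Real.exp (g x) * h x ∂μ ≤ entropyExp μ g := by
  set m := ∫ x, Real.exp (g x) ∂μ with hm
  have hm0 : 0 < m := hg.integral_exp_pos μ
  -- This is `u + 1 ≤ e^u` at `u = h - g + log m`, multiplied by `e^g`.
  have hpt : ∀ x, Real.exp (g x) * h x
      ≤ (g x * Real.exp (g x) - (Real.log m + 1) * Real.exp (g x)) + m * Real.exp (h x) := by
    intro x
    have e : m * Real.exp (h x) = Real.exp (g x) * Real.exp (-(g x - Real.log m - h x)) := by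
      rw [← Real.exp_add, show g x + -(g x - Real.log m - h x) = Real.log m + h x by ring,
        Real.exp_add, Real.exp_log hm0]
    have := Real.add_one_le_exp (-(g x - Real.log m - h x))
    rw [e]
    nlinarith [Real.exp_pos (g x)]
  have i1 := (hg.mul hg.exp).integrable μ
  have i2 := ((BoundedMeasurable.const (Real.log m + 1)).mul hg.exp).integrable μ
  have i3 := ((BoundedMeasurable.const m).mul hh.exp).integrable μ
  have i12 : Integrable (fun x => g x * Real.exp (g x) - (Real.log m + 1) * Real.exp (g x)) μ :=
    i1.sub i2
  refine (integral_mono ((hg.exp.mul hh).integrable μ) (i12.add i3) hpt).trans_eq ?_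
  rw [integral_add' i12 i3, integral_sub i1 i2, integral_const_mul, integral_const_mul, h1,
    ← hm, entropyExp, ← hm]
  ring

theorem sub_mul_exp_sub_exp_le (a b : ℝ) :
    (a - b) * (Real.exp a - Real.exp b) ≤ (a - b) ^ 2 * (Real.exp a + Real.exp b) := by
  have key : ∀ a b : ℝ, b ≤ a → (a - b) * (Real.exp a - Real.exp b)
      ≤ (a - b) ^ 2 * (Real.exp a + Real.exp b) := by
    intro a b h
    have h1 := Real.add_one_le_exp (b - a)
    have h2 : Real.exp b = Real.exp a * Real.exp (b - a) := by rw [← Real.exp_add]; ring_nf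
    have h3 : Real.exp a - Real.exp b ≤ (a - b) * Real.exp a := by
      rw [h2]; nlinarith [Real.exp_pos a]
    have h4 : 0 ≤ a - b := sub_nonneg.2 h
    nlinarith [mul_le_mul_of_nonneg_left h3 h4, mul_nonneg (sq_nonneg (a - b)) (Real.exp_pos b).le]
  rcases le_total b a with h | h
  · exact key a b h
  · have := key b a h
    nlinarith

/-- Jensen bounds the entropy by the covariance of `g` and `e^g`. Written with an independent copy,
this is half the mean of `(g - g')(e^g - e^{g'})`; symmetrizing the pointwise bound absorbs the
half. -/
theorem entropyExp_le_integral_sq (ν : Measure α) [IsProbabilityMeasure ν] {g : α → ℝ}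
    (hg : BoundedMeasurable g) :
    entropyExp ν g ≤ ∫ t, ∫ s, (g t - g s) ^ 2 * Real.exp (g t) ∂ν ∂ν := by
  set m := ∫ x, Real.exp (g x) ∂ν with hm
  have hm0 : 0 < m := hg.integral_exp_pos ν
  have hlog : ∫ x, g x ∂ν ≤ Real.log m := by
    have hpt : ∀ x, g x ≤ (Real.log m - 1) + m⁻¹ * Real.exp (g x) := by
      intro x
      have := Real.add_one_le_exp (g x - Real.log m)
      rw [Real.exp_sub, Real.exp_log hm0, div_eq_inv_mul] at this
      linarith
    have := integral_mono (hg.integrable ν)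
      (((BoundedMeasurable.const _).add ((BoundedMeasurable.const _).mul hg.exp)).integrable ν) hpt
    refine this.trans_eq ?_
    rw [integral_add (integrable_const _)
      (((BoundedMeasurable.const _).mul hg.exp).integrable ν), integral_const_mul, ← hm]
    simp [hm0.ne']
  have h1 : BoundedMeasurable fun p : α × α => g p.1 := hg.comp measurable_fst
  have h2 : BoundedMeasurable fun p : α × α => g p.2 := hg.comp measurable_snd
  have hΦ : BoundedMeasurable fun p : α × α => (g p.1 - g p.2) ^ 2 * Real.exp (g p.1) :=
    (h1.sub h2).pow_two.mul h1.exp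
  have hΦ' : BoundedMeasurable fun p : α × α => (g p.2 - g p.1) ^ 2 * Real.exp (g p.2) :=
    (h2.sub h1).pow_two.mul h2.exp
  have hΨ : BoundedMeasurable fun p : α × α => (g p.1 - g p.2) * Real.exp (g p.1) :=
    (h1.sub h2).mul h1.exp
  have hΨ' : BoundedMeasurable fun p : α × α => (g p.2 - g p.1) * Real.exp (g p.2) :=
    (h2.sub h1).mul h2.exp
  have sΦ := integral_prod_swap (μ := ν) (ν := ν)
    (fun p : α × α => (g p.1 - g p.2) ^ 2 * Real.exp (g p.1))
  have sΨ := integral_prod_swap (μ := ν) (ν := ν)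
    (fun p : α × α => (g p.1 - g p.2) * Real.exp (g p.1))
  simp only [Prod.fst_swap, Prod.snd_swap] at sΦ sΨ
  have hle := integral_mono ((hΨ.add hΨ').integrable (ν.prod ν)) ((hΦ.add hΦ').integrable (ν.prod ν))
    (fun p => by
      have := sub_mul_exp_sub_exp_le (g p.1) (g p.2)
      simp only
      linarith)
  rw [integral_add (hΨ.integrable _) (hΨ'.integrable _),
    integral_add (hΦ.integrable _) (hΦ'.integrable _), sΦ, sΨ] at hle
  have eΨ : ∫ p : α × α, (g p.1 - g p.2) * Real.exp (g p.1) ∂(ν.prod ν)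
      = ∫ x, g x * Real.exp (g x) ∂ν - m * ∫ x, g x ∂ν := by
    have e1 := integral_prod_mul (μ := ν) (ν := ν) (fun x => g x * Real.exp (g x)) (fun _ => (1 : ℝ))
    have e2 := integral_prod_mul (μ := ν) (ν := ν) (fun x => Real.exp (g x)) g
    simp only [mul_one, integral_const, probReal_univ, smul_eq_mul] at e1
    rw [← e1, hm, ← e2, ← integral_sub ((h1.mul h1.exp).integrable _) ((h1.exp.mul h2).integrable _)]
    refine integral_congr_ae (Filter.Eventually.of_forall fun p => ?_)
    simp only
    ring
  rw [← integral_prod _ (hΦ.integrable _)]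
  have : m * ∫ x, g x ∂ν ≤ m * Real.log m := by gcongr
  rw [entropyExp, ← hm]
  linarith

theorem BoundedMeasurable.entropyExp_right {g : α × β → ℝ} (hg : BoundedMeasurable g)
    (ν : Measure β) [IsProbabilityMeasure ν] :
    BoundedMeasurable fun x => entropyExp ν fun y => g (x, y) := by
  obtain ⟨B, hB⟩ := hg.bounded
  have hF := hg.exp.integral_snd ν
  have hL : BoundedMeasurable fun x => Real.log (∫ y, Real.exp (g (x, y)) ∂ν) :=
    ⟨hF.measurable.log, B, fun x =>
      (hg.comp measurable_prodMk_left).log_integral_exp ν fun y => hB (x, y)⟩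
  exact ((hg.mul hg.exp).integral_snd ν).sub (hF.mul hL)

/-- The chain rule splits the entropy into the mean entropy along `ν` and the entropy of the
marginal `F`. The latter is bounded by testing each slice's variational formula with the same
function `log (F / m)`. -/
theorem entropyExp_prod_le (μ : Measure α) (ν : Measure β) [IsProbabilityMeasure μ]
    [IsProbabilityMeasure ν] {g : α × β → ℝ} (hg : BoundedMeasurable g) :
    entropyExp (μ.prod ν) g
      ≤ ∫ x, entropyExp ν (fun y => g (x, y)) ∂μ + ∫ y, entropyExp μ (fun x => g (x, y)) ∂ν := by
  obtain ⟨B, hB⟩ := hg.bounded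
  have hF := hg.exp.integral_snd ν
  have hL : BoundedMeasurable fun x => Real.log (∫ y, Real.exp (g (x, y)) ∂ν) :=
    ⟨hF.measurable.log, B, fun x =>
      (hg.comp measurable_prodMk_left).log_integral_exp ν fun y => hB (x, y)⟩
  have hFpos : ∀ x, 0 < ∫ y, Real.exp (g (x, y)) ∂ν := fun x =>
    (hg.comp measurable_prodMk_left).integral_exp_pos ν
  set F := fun x => ∫ y, Real.exp (g (x, y)) ∂ν with hFdef
  have hm0 : 0 < ∫ p, Real.exp (g p) ∂(μ.prod ν) := hg.integral_exp_pos _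
  have hm : ∫ p, Real.exp (g p) ∂(μ.prod ν) = ∫ x, F x ∂μ :=
    integral_prod _ (hg.exp.integrable _)
  rw [hm] at hm0
  set m := ∫ x, F x ∂μ with hmdef
  have hge : ∫ p, g p * Real.exp (g p) ∂(μ.prod ν) = ∫ x, ∫ y, g (x, y) * Real.exp (g (x, y)) ∂ν ∂μ :=
    integral_prod _ ((hg.mul hg.exp).integrable _)
  have h1 : ∫ x, entropyExp ν (fun y => g (x, y)) ∂μ
      = ∫ x, ∫ y, g (x, y) * Real.exp (g (x, y)) ∂ν ∂μ - ∫ x, F x * Real.log (F x) ∂μ :=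
    integral_sub (((hg.mul hg.exp).integral_snd ν).integrable μ) ((hF.mul hL).integrable μ)
  have hh : BoundedMeasurable fun x => Real.log (F x) - Real.log m :=
    hL.sub (BoundedMeasurable.const _)
  have hh1 : ∫ x, Real.exp (Real.log (F x) - Real.log m) ∂μ = 1 := by
    have : ∀ x, Real.exp (Real.log (F x) - Real.log m) = F x / m := fun x => by
      rw [Real.exp_sub, Real.exp_log (hFpos x), Real.exp_log hm0]
    simp only [this]
    rw [integral_div, ← hmdef, div_self hm0.ne']
  have hgh : BoundedMeasurable fun p : α × β =>
      Real.exp (g p) * (Real.log (F p.1) - Real.log m) :=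
    hg.exp.mul (hh.comp measurable_fst)
  have h2 : ∫ x, F x * Real.log (F x) ∂μ - m * Real.log m
      = ∫ y, ∫ x, Real.exp (g (x, y)) * (Real.log (F x) - Real.log m) ∂μ ∂ν := by
    rw [← integral_prod_symm _ (hgh.integrable _), integral_prod _ (hgh.integrable _)]
    simp only [integral_mul_const]
    rw [hmdef, ← integral_mul_const, ← integral_sub ((hF.mul hL).integrable μ)
      ((hF.mul (BoundedMeasurable.const _)).integrable μ)]
    simp only [mul_sub, hFdef]
  have h3 : ∫ y, ∫ x, Real.exp (g (x, y)) * (Real.log (F x) - Real.log m) ∂μ ∂ν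
      ≤ ∫ y, entropyExp μ (fun x => g (x, y)) ∂ν := by
    refine integral_mono ((hgh.comp measurable_swap).integral_snd μ |>.integrable ν)
      (((hg.comp measurable_swap).entropyExp_right μ).integrable ν) fun y => ?_
    exact integral_exp_mul_le_entropyExp μ (hg.comp measurable_prodMk_right) hh hh1
  rw [entropyExp, hm, hge, h1]
  linarith

theorem integral_pi_succ {n : ℕ} (ν : Fin (n + 1) → Measure α) [∀ i, IsProbabilityMeasure (ν i)]
    (f : (Fin (n + 1) → α) → ℝ) :
    ∫ x, f x ∂(Measure.pi ν)
      = ∫ p : α × (Fin n → α), f (Fin.cons p.1 p.2) ∂((ν 0).prod (Measure.pi fun j => ν j.succ)) := by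
  have h := (measurePreserving_piFinSuccAbove ν 0).symm
  have h2 := h.integral_comp' f
  have h3 : ∀ p : α × (Fin n → α), (MeasurableEquiv.piFinSuccAbove (fun _ => α) 0).symm p
      = Fin.cons p.1 p.2 := fun p => Fin.insertNth_zero' p.1 p.2
  rw [← h2]
  simp only [h3, Fin.succAbove_zero]

theorem measurable_fin_cons {n : ℕ} :
    Measurable fun p : α × (Fin n → α) => (Fin.cons p.1 p.2 : Fin (n + 1) → α) := by
  refine measurable_pi_iff.2 fun i => ?_
  refine Fin.cases ?_ (fun j => ?_) i
  · simpa using measurable_fst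
  · simp only [Fin.cons_succ]
    exact (measurable_pi_apply j).comp measurable_snd

theorem measurable_update_pair {ι : Type*} [DecidableEq ι] (i : ι) :
    Measurable fun p : (ι → α) × α => Function.update p.1 i p.2 := by
  refine measurable_pi_iff.2 fun j => ?_
  by_cases h : j = i
  · subst h; simpa using measurable_snd
  · simp only [Function.update_of_ne h]
    exact (measurable_pi_apply j).comp measurable_fst

theorem BoundedMeasurable.sq_update {ι : Type*} [DecidableEq ι] {g : (ι → α) → ℝ}
    (hg : BoundedMeasurable g) (i : ι) :
    BoundedMeasurable fun p : (ι → α) × α =>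
      (g p.1 - g (Function.update p.1 i p.2)) ^ 2 * Real.exp (g p.1) :=
  ((hg.comp measurable_fst).sub (hg.comp (measurable_update_pair i))).pow_two.mul
    (hg.comp measurable_fst).exp

/-- Tensorization of the modified logarithmic Sobolev inequality. -/
theorem entropyExp_pi_le {n : ℕ} (ν : Fin n → Measure α) [∀ i, IsProbabilityMeasure (ν i)]
    {g : (Fin n → α) → ℝ} (hg : BoundedMeasurable g) :
    entropyExp (Measure.pi ν) g ≤ ∑ i, ∫ x, ∫ s,
      (g x - g (Function.update x i s)) ^ 2 * Real.exp (g x) ∂(ν i) ∂(Measure.pi ν) := by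
  induction n with
  | zero =>
    have hc : ∀ x, g x = g default := fun x => congrArg g (Subsingleton.elim _ _)
    simp only [entropyExp, hc, integral_const, probReal_univ, smul_eq_mul, one_mul, Real.log_exp,
      Finset.univ_eq_empty, Finset.sum_empty]
    linarith
  | succ n ih =>
    have hG : BoundedMeasurable fun p : α × (Fin n → α) => g (Fin.cons p.1 p.2) :=
      hg.comp measurable_fin_cons
    have he : entropyExp (Measure.pi ν) g = entropyExp ((ν 0).prod (Measure.pi fun j => ν j.succ))
        (fun p : α × (Fin n → α) => g (Fin.cons p.1 p.2)) := by
      simp only [entropyExp, integral_pi_succ]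
    rw [he, Fin.sum_univ_succ]
    -- The slices with fixed head use the induction hypothesis; those with fixed tail use the
    -- one-coordinate inequality.
    refine ((entropyExp_prod_le _ _ hG).trans (add_le_add ?_ ?_)).trans_eq (add_comm _ _)
    · have hbd : ∀ i : Fin n, BoundedMeasurable fun a : α =>
          ∫ x, ∫ s, (g (Fin.cons a x) - g (Fin.cons a (Function.update x i s))) ^ 2
            * Real.exp (g (Fin.cons a x)) ∂(ν i.succ) ∂(Measure.pi fun j => ν j.succ) := by
        intro i
        have hm : Measurable fun q : (α × (Fin n → α)) × α =>
            ((Fin.cons q.1.1 q.1.2 : Fin (n + 1) → α), q.2) :=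
          (measurable_fin_cons.comp measurable_fst).prodMk measurable_snd
        have := (((hg.sq_update i.succ).comp hm).integral_snd (ν i.succ)).integral_snd
          (Measure.pi fun j => ν j.succ)
        simpa only [Fin.cons_update] using this
      have hle := integral_mono ((hG.entropyExp_right (Measure.pi fun j => ν j.succ)).integrable (ν 0))
        (integrable_finsetSum Finset.univ fun i _ => (hbd i).integrable (ν 0))
        (fun a => by
          simpa using ih (fun j => ν j.succ) (g := fun x => g (Fin.cons a x))
            (hG.comp measurable_prodMk_left))
      refine hle.trans_eq ?_
      rw [integral_finsetSum _ fun i _ => (hbd i).integrable (ν 0)]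
      refine Finset.sum_congr rfl fun i _ => ?_
      rw [integral_pi_succ, integral_prod]
      · simp only [Fin.cons_update]
      · exact (((hg.sq_update i.succ).integral_snd (ν i.succ)).comp
          measurable_fin_cons).integrable _
    · rw [integral_pi_succ, integral_prod_symm _
        ((((hg.sq_update 0).integral_snd (ν 0)).comp measurable_fin_cons).integrable _)]
      refine integral_mono
        (((hG.comp measurable_swap).entropyExp_right (ν 0)).integrable _) ?_ fun x => ?_
      · have := ((((hg.sq_update 0).integral_snd (ν 0)).comp measurable_fin_cons).comp
          measurable_swap).integral_snd (ν 0)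
        exact this.integrable _
      · simp only [Fin.update_cons_zero]
        exact entropyExp_le_integral_sq (ν 0) (hG.comp measurable_prodMk_right)

end

/-! ### Herbst's argument and exponential moments -/

theorem BoundedMeasurable.integrableExpSet_eq {α : Type*} [MeasurableSpace α] {μ : Measure α}
    [IsProbabilityMeasure μ] {W : α → ℝ} (hW : BoundedMeasurable W) :
    integrableExpSet W μ = Set.univ :=
  Set.eq_univ_of_forall fun l => ((BoundedMeasurable.const l).mul hW).exp.integrable μ

/-- Herbst's argument for self-bounding functions. -/
theorem mgf_le_of_entropyExp_le {α : Type*} [MeasurableSpace α] (μ : Measure α)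
    [IsProbabilityMeasure μ] {W : α → ℝ} (hW : BoundedMeasurable W) {c : ℝ} (hc : 0 < c)
    (h : ∀ l : ℝ, entropyExp μ (fun x => l * W x)
      ≤ c * l ^ 2 * ∫ x, W x * Real.exp (l * W x) ∂μ) {l : ℝ} (hl : c * l < 1) :
    mgf W μ l ≤ Real.exp (l * (∫ x, W x ∂μ) / (1 - c * l)) := by
  have hmem : ∀ l, l ∈ interior (integrableExpSet W μ) := fun l => by
    rw [hW.integrableExpSet_eq, interior_univ]; trivial
  have hF0 : ∀ l, 0 < mgf W μ l := fun l => ((BoundedMeasurable.const l).mul hW).integral_exp_pos μ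
  have hderiv : ∀ l, HasDerivAt (cgf W μ) ((∫ x, W x * Real.exp (l * W x) ∂μ) / mgf W μ l) l :=
    fun l => (hasDerivAt_mgf (hmem l)).log (hF0 l).ne'
  have hkey : ∀ l, l * (1 - c * l) * ((∫ x, W x * Real.exp (l * W x) ∂μ) / mgf W μ l)
      ≤ cgf W μ l := by
    intro l
    have h1 := h l
    have e : ∫ x, l * W x * Real.exp (l * W x) ∂μ = l * ∫ x, W x * Real.exp (l * W x) ∂μ := by
      simp only [mul_assoc, integral_const_mul]
    rw [entropyExp, e] at h1
    change _ - mgf W μ l * cgf W μ l ≤ _ at h1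
    rw [← mul_div_assoc, div_le_iff₀ (hF0 l)]
    nlinarith
  -- With `ψ` the cumulant generating function, the entropy bound reads `l (1 - c l) ψ' ≤ ψ`, which
  -- says exactly that `r' ≤ 0` away from `0`. As `r` tends to the mean of `W` at `0`, monotonicity
  -- on either side gives the bound for both signs of `l`.
  set r : ℝ → ℝ := fun l => cgf W μ l * (1 - c * l) / l with hr
  have hrderiv : ∀ l, l ≠ 0 → ∃ r', HasDerivAt r r' l ∧ (c * l < 1 → r' ≤ 0) := by
    intro l hl0
    have h1 : HasDerivAt (fun l => 1 - c * l) (-(c * 1)) l :=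
      ((hasDerivAt_id l).const_mul c).const_sub 1
    refine ⟨_, ((hderiv l).mul h1).div (hasDerivAt_id l) hl0, fun _ => ?_⟩
    refine div_nonpos_of_nonpos_of_nonneg ?_ (sq_nonneg _)
    have := hkey l
    simp only [Pi.mul_apply]
    nlinarith
  have hlim : Filter.Tendsto r (nhdsWithin 0 {0}ᶜ) (nhds (∫ x, W x ∂μ)) := by
    have h1 := (hderiv 0).tendsto_slope
    have h2 : Filter.Tendsto (fun l : ℝ => 1 - c * l) (nhdsWithin 0 {0}ᶜ) (nhds 1) := by
      have : Continuous fun l : ℝ => 1 - c * l := by fun_prop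
      simpa using (this.tendsto 0).mono_left nhdsWithin_le_nhds
    have h3 := h1.mul h2
    simp only [zero_mul, Real.exp_zero, mul_one, mgf_zero, div_one] at h3
    refine h3.congr fun l => ?_
    rw [slope_def_field, cgf_zero, hr]
    ring
  have hanti : ∀ D : Set ℝ, Convex ℝ D → IsOpen D → (∀ l ∈ D, l ≠ 0 ∧ c * l < 1) →
      AntitoneOn r D := by
    intro D hD hDo hDl
    refine antitoneOn_of_deriv_nonpos hD (fun l hl => ?_) (fun l hl => ?_) fun l hl => ?_
    · obtain ⟨r', h1, -⟩ := hrderiv l (hDl l hl).1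
      exact h1.continuousAt.continuousWithinAt
    · obtain ⟨r', h1, -⟩ := hrderiv l (hDl l (interior_subset hl)).1
      exact h1.differentiableAt.differentiableWithinAt
    · obtain ⟨r', h1, h2⟩ := hrderiv l (hDl l (interior_subset hl)).1
      rw [h1.deriv]
      exact h2 (hDl l (interior_subset hl)).2
  have h1cl : 0 < 1 - c * l := by linarith
  have hmain : cgf W μ l ≤ l * (∫ x, W x ∂μ) / (1 - c * l) := by
    rw [le_div_iff₀ h1cl]
    rcases lt_trichotomy l 0 with hneg | rfl | hpos
    · have ha := hanti (Set.Iio 0) (convex_Iio 0) isOpen_Iio fun l hl => by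
        have hl' : l < 0 := hl
        exact ⟨hl'.ne, by nlinarith⟩
      have hle : ∫ x, W x ∂μ ≤ r l := by
        have : (nhdsWithin (0 : ℝ) (Set.Ioo l 0)).NeBot := by
          rw [nhdsWithin_Ioo_eq_nhdsLT hneg]; infer_instance
        refine le_of_tendsto (hlim.mono_left (nhdsWithin_mono 0 (s := Set.Ioo l 0) fun x hx => hx.2.ne)) ?_
        filter_upwards [self_mem_nhdsWithin] with δ hδ
        exact ha hneg hδ.2 hδ.1.le
      rw [hr] at hle
      simp only at hle
      rw [le_div_iff_of_neg hneg] at hle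
      linarith
    · simp
    · have ha := hanti (Set.Ioo 0 (1 / c)) (convex_Ioo _ _) isOpen_Ioo fun l hl => by
        refine ⟨hl.1.ne', ?_⟩
        have := hl.2
        rw [lt_div_iff₀ hc] at this
        linarith
      have hle : r l ≤ ∫ x, W x ∂μ := by
        have : (nhdsWithin (0 : ℝ) (Set.Ioo 0 l)).NeBot := by
          rw [nhdsWithin_Ioo_eq_nhdsGT hpos]; infer_instance
        refine ge_of_tendsto (hlim.mono_left (nhdsWithin_mono 0 (s := Set.Ioo 0 l) fun x hx => hx.1.ne')) ?_
        filter_upwards [self_mem_nhdsWithin] with δ hδ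
        have hlc : l < 1 / c := by rw [lt_div_iff₀ hc]; linarith
        exact ha ⟨hδ.1, hδ.2.trans hlc⟩ ⟨hpos, hlc⟩ hδ.2.le
      rw [hr] at hle
      simp only at hle
      rw [div_le_iff₀ hpos] at hle
      linarith
  calc mgf W μ l = Real.exp (cgf W μ l) := (Real.exp_log (hF0 l)).symm
    _ ≤ _ := Real.exp_le_exp.2 hmain

theorem entropyExp_pi_le_of_selfBounding {α : Type*} [MeasurableSpace α] {n : ℕ}
    (ν : Fin n → Measure α) [∀ i, IsProbabilityMeasure (ν i)] {W : (Fin n → α) → ℝ}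
    (hW : BoundedMeasurable W) {c : ℝ}
    (hself : ∀ x, ∃ b : Fin n → ℝ, (∀ i s, (W x - W (Function.update x i s)) ^ 2 ≤ b i) ∧
      ∑ i, b i ≤ c * W x) (l : ℝ) :
    entropyExp (Measure.pi ν) (fun x => l * W x)
      ≤ c * l ^ 2 * ∫ x, W x * Real.exp (l * W x) ∂(Measure.pi ν) := by
  have hg : BoundedMeasurable fun x => l * W x := (BoundedMeasurable.const l).mul hW
  have hq := fun i => (hg.sq_update i).integral_snd (ν i)
  refine (entropyExp_pi_le ν hg).trans ?_
  rw [← integral_finsetSum _ fun i _ => (hq i).integrable _, ← integral_const_mul]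
  refine integral_mono (integrable_finsetSum _ fun i _ => (hq i).integrable _)
    (((BoundedMeasurable.const _).mul (hW.mul hg.exp)).integrable _) fun x => ?_
  obtain ⟨b, hb1, hb2⟩ := hself x
  calc ∑ i, ∫ s, (l * W x - l * W (Function.update x i s)) ^ 2 * Real.exp (l * W x) ∂(ν i)
      ≤ ∑ i, l ^ 2 * b i * Real.exp (l * W x) := by
        refine Finset.sum_le_sum fun i _ => ?_
        have hi : Integrable (fun s => (l * W x - l * W (Function.update x i s)) ^ 2
            * Real.exp (l * W x)) (ν i) :=
          ((hg.sq_update i).comp measurable_prodMk_left).integrable _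
        refine (integral_mono hi (integrable_const (l ^ 2 * b i * Real.exp (l * W x)))
          fun s => ?_).trans_eq (by simp)
        have := hb1 i s
        calc (l * W x - l * W (Function.update x i s)) ^ 2 * Real.exp (l * W x)
            = l ^ 2 * (W x - W (Function.update x i s)) ^ 2 * Real.exp (l * W x) := by ring
          _ ≤ _ := by gcongr
    _ = l ^ 2 * (∑ i, b i) * Real.exp (l * W x) := by rw [← Finset.sum_mul, ← Finset.mul_sum]
    _ ≤ l ^ 2 * (c * W x) * Real.exp (l * W x) := by gcongr
    _ = _ := by ring

/-! ### Infinitely many variables and tail bounds -/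

/-- Extension of a finite sequence by zeros. -/
def extendZero {n : ℕ} (x : Fin n → ℝ) (i : ℕ) : ℝ := if h : i < n then x ⟨i, h⟩ else 0

theorem continuous_extendZero {n : ℕ} : Continuous (extendZero (n := n)) := by
  refine continuous_pi fun i => ?_
  by_cases h : i < n
  · simpa only [extendZero, h, dif_pos] using continuous_apply _
  · simpa only [extendZero, h, dif_neg, not_false_eq_true] using continuous_const

theorem extendZero_update {n : ℕ} (x : Fin n → ℝ) (i : Fin n) (s : ℝ) :
    extendZero (Function.update x i s) = Function.update (extendZero x) i s := by
  funext j
  by_cases hj : j = i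
  · subst hj; simp [extendZero]
  · rw [Function.update_of_ne hj]
    unfold extendZero
    split
    · rw [Function.update_of_ne]
      rintro rfl
      exact hj rfl
    · rfl

/-- Exponential moments of a continuous self-bounding function of independent variables. -/
theorem mgf_le_of_selfBounding {Ω : Type*} [MeasurableSpace Ω] {P : Measure Ω}
    [IsProbabilityMeasure P] {X : ℕ → Ω → ℝ} (hX : ∀ i, Measurable (X i)) (hind : iIndepFun X P)
    {W : (ℕ → ℝ) → ℝ} (hW : Continuous W) {A : ℝ} (hA : ∀ v, |W v| ≤ A) {c : ℝ} (hc : 0 < c)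
    (hself : ∀ v, ∃ b : ℕ → ℝ, (∀ i s, (W v - W (Function.update v i s)) ^ 2 ≤ b i) ∧
      ∀ n, ∑ i ∈ Finset.range n, b i ≤ c * W v) {l : ℝ} (hl : c * l < 1) :
    mgf (fun ω => W fun i => X i ω) P l
      ≤ Real.exp (l * (∫ ω, W (fun i => X i ω) ∂P) / (1 - c * l)) := by
  set Y : (n : ℕ) → Ω → ℝ := fun n ω => W (extendZero fun i : Fin n => X i ω) with hY
  have hYm : ∀ n, Measurable fun ω => fun i : Fin n => X i ω := fun n =>
    measurable_pi_iff.2 fun i => hX i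
  have hYb : ∀ n, BoundedMeasurable (Y n) := fun n =>
    ⟨(hW.comp continuous_extendZero).measurable.comp (hYm n), A, fun ω => hA _⟩
  have hfin : ∀ n, mgf (Y n) P l ≤ Real.exp (l * (∫ ω, Y n ω ∂P) / (1 - c * l)) := by
    intro n
    have hWn : BoundedMeasurable fun x : Fin n → ℝ => W (extendZero x) :=
      ⟨(hW.comp continuous_extendZero).measurable, A, fun x => hA _⟩
    have hprob : ∀ i : Fin n, IsProbabilityMeasure (P.map (X i)) := fun i =>
      Measure.isProbabilityMeasure_map (hX i).aemeasurable
    have hmap := (iIndepFun_iff_map_fun_eq_pi_map fun i : Fin n => (hX i).aemeasurable).1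
      (hind.precomp Fin.val_injective)
    have h1 := mgf_le_of_entropyExp_le (Measure.pi fun i : Fin n => P.map (X i)) hWn hc
      (entropyExp_pi_le_of_selfBounding _ hWn fun x => by
        obtain ⟨b, hb1, hb2⟩ := hself (extendZero x)
        refine ⟨fun i => b i, fun i s => ?_, ?_⟩
        · rw [extendZero_update]; exact hb1 i s
        · rw [Fin.sum_univ_eq_sum_range]; exact hb2 n) hl
    rw [← hmap, mgf_map (hYm n).aemeasurable, integral_map (hYm n).aemeasurable] at h1
    · exact h1
    · exact hWn.measurable.aestronglyMeasurable
    · exact ((BoundedMeasurable.const l).mul hWn).exp.measurable.aestronglyMeasurable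
  -- Each coordinate of the truncated sequence is eventually exact, so continuity of `W` in the
  -- product topology suffices.
  have hpt : ∀ ω, Filter.Tendsto (fun n => Y n ω) Filter.atTop (nhds (W fun i => X i ω)) := by
    intro ω
    refine (hW.tendsto _).comp (tendsto_pi_nhds.2 fun i => ?_)
    refine tendsto_const_nhds.congr' ?_
    filter_upwards [Filter.eventually_gt_atTop i] with n hn
    simp [extendZero, hn]
  have hE : Filter.Tendsto (fun n => ∫ ω, Y n ω ∂P) Filter.atTop
      (nhds (∫ ω, W (fun i => X i ω) ∂P)) :=
    tendsto_integral_of_dominated_convergence (fun _ => A)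
      (fun n => (hYb n).measurable.aestronglyMeasurable) (integrable_const A)
      (fun n => Filter.Eventually.of_forall fun ω => hA _) (Filter.Eventually.of_forall hpt)
  have hM : Filter.Tendsto (fun n => mgf (Y n) P l) Filter.atTop
      (nhds (mgf (fun ω => W fun i => X i ω) P l)) := by
    refine tendsto_integral_of_dominated_convergence (fun _ => Real.exp (|l| * A))
      (fun n => ((BoundedMeasurable.const l).mul (hYb n)).exp.measurable.aestronglyMeasurable)
      (integrable_const _) (fun n => Filter.Eventually.of_forall fun ω => ?_)
      (Filter.Eventually.of_forall fun ω =>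
        (Real.continuous_exp.tendsto _).comp ((hpt ω).const_mul l))
    rw [Real.norm_of_nonneg (Real.exp_pos _).le, Real.exp_le_exp]
    refine (le_abs_self _).trans ?_
    rw [abs_mul]
    exact mul_le_mul_of_nonneg_left (hA _) (abs_nonneg l)
  refine le_of_tendsto_of_tendsto' hM ?_ hfin
  exact (Real.continuous_exp.tendsto _).comp ((hE.const_mul l).div_const _)

/-- Bernstein-type tails from the exponential moments of a self-bounding variable. -/
theorem tails_of_mgf_le {Ω : Type*} [MeasurableSpace Ω] {P : Measure Ω} [IsProbabilityMeasure P]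
    {W : Ω → ℝ} (hW : BoundedMeasurable W) {c m : ℝ} (hc : 0 < c) (hm : 0 < m)
    (h : ∀ l, c * l < 1 → mgf W P l ≤ Real.exp (l * m / (1 - c * l))) {t : ℝ} (ht : 0 ≤ t) :
    P.real {ω | W ω ≤ m - t} ≤ Real.exp (-(t ^ 2 / (8 * c * m))) ∧
      P.real {ω | m + t ≤ W ω} ≤ Real.exp (-(t ^ 2 / (8 * c * (m + t)))) := by
  have hint : ∀ l, Integrable (fun ω => Real.exp (l * W ω)) P := fun l =>
    ((BoundedMeasurable.const l).mul hW).exp.integrable P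
  have hexp : ∀ l, c * l < 1 → l * m / (1 - c * l) = l * m + c * l ^ 2 * m / (1 - c * l) := by
    intro l hl
    have : (1 - c * l) ≠ 0 := by linarith
    rw [div_eq_iff this, add_mul, div_mul_cancel₀ _ this]
    ring
  constructor
  -- For `l ≤ 0` the denominator `1 - c l` is at least `1` and can be dropped; this `l` then
  -- minimises `l t + c l² m`.
  · set l := -(t / (2 * c * m)) with hl
    have hl0 : l ≤ 0 := neg_nonpos.2 (by positivity)
    have hcl : c * l ≤ 0 := mul_nonpos_of_nonneg_of_nonpos hc.le hl0
    have h1 := measure_le_le_exp_mul_mgf (m - t) hl0 (hint l)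
    refine h1.trans ((mul_le_mul_of_nonneg_left (h l (by linarith)) (Real.exp_pos _).le).trans ?_)
    rw [← Real.exp_add, Real.exp_le_exp, hexp l (by linarith)]
    have h2 : c * l ^ 2 * m / (1 - c * l) ≤ c * l ^ 2 * m :=
      div_le_self (by positivity) (by linarith)
    have h3 : l * t + c * l ^ 2 * m = -(2 * (t ^ 2 / (8 * c * m))) := by
      rw [hl]; field_simp; ring
    have h4 : 0 ≤ t ^ 2 / (8 * c * m) := by positivity
    linarith
  -- Having `m + t` in place of `m` keeps `c l ≤ 1/4` for every `t`, so the denominator costs at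
  -- most a factor `2`.
  · set l := t / (4 * c * (m + t)) with hl
    have hl0 : 0 ≤ l := by positivity
    have hcl : c * l ≤ 1 / 4 := by
      rw [hl, mul_div_assoc', div_le_iff₀ (by positivity)]
      nlinarith
    have h1 := measure_ge_le_exp_mul_mgf (m + t) hl0 (hint l)
    refine h1.trans ((mul_le_mul_of_nonneg_left (h l (by linarith)) (Real.exp_pos _).le).trans ?_)
    rw [← Real.exp_add, Real.exp_le_exp, hexp l (by linarith)]
    have h2 : c * l ^ 2 * m / (1 - c * l) ≤ 2 * (c * l ^ 2 * m) := by
      rw [div_le_iff₀ (by linarith)]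
      have : 0 ≤ c * l ^ 2 * m := by positivity
      nlinarith
    have h3 : 2 * (c * l ^ 2 * m) ≤ l * t / 2 := by
      have e : 4 * c * l * (m + t) = t := by rw [hl]; field_simp
      have : 4 * c * l * m ≤ t := by nlinarith [mul_nonneg (mul_nonneg hc.le hl0) ht]
      nlinarith
    have h4 : l * t / 2 = t ^ 2 / (8 * c * (m + t)) := by
      rw [hl]; field_simp; ring
    linarith

/-! ### The truncated potential and the conclusion -/

/-- Truncation of a real number to `[ε, M]`. -/
def clamp (ε M s : ℝ) : ℝ := max ε (min s M)

theorem le_clamp (ε M s : ℝ) : ε ≤ clamp ε M s := le_max_left _ _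

theorem clamp_le {ε M : ℝ} (h : ε ≤ M) (s : ℝ) : clamp ε M s ≤ M := max_le h (min_le_right _ _)

theorem clamp_of_mem {ε M s : ℝ} (h1 : ε ≤ s) (h2 : s ≤ M) : clamp ε M s = s := by
  rw [clamp, min_eq_left h2, max_eq_right h1]

theorem continuous_clamp (ε M : ℝ) : Continuous (clamp ε M) := by
  unfold clamp; fun_prop

/-- The constant in the self-bounding inequality for `ρ`. -/
noncomputable def selfBoundingConst (ε M : ℝ) : ℝ :=
  (M * ((1 + M) / ε) ^ 2) ^ 2 * (2 / ε ^ 2) * (1 + Real.log (1 + M) + |Real.log (2 / ε)|)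

theorem selfBoundingConst_pos {ε M : ℝ} (hε : 0 < ε) (hM : 0 < M) : 0 < selfBoundingConst ε M := by
  have : 0 ≤ Real.log (1 + M) := Real.log_nonneg (by linarith)
  unfold selfBoundingConst
  positivity

/-- `ρ(o, x) + 1` as a function of the potential listed along an enumeration of the lattice
and truncated to `[ε, M]`. -/
noncomputable def clampedRho {d : ℕ} (ε M : ℝ) (e : Lattice d ≃ ℕ) (o x : Lattice d)
    (v : ℕ → ℝ) : ℝ :=
  rho (fun z => clamp ε M (v (e z))) o x + 1

theorem continuous_clampedRho {d : ℕ} (hd : 0 < d) {ε M : ℝ} (hε : 0 < ε) (hεM : ε ≤ M)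
    (e : Lattice d ≃ ℕ) (o x : Lattice d) : Continuous (clampedRho ε M e o x) := by
  refine Continuous.add ?_ continuous_const
  refine (continuousOn_rho hd hε (M := M) o x).comp_continuous
    (f := fun (v : ℕ → ℝ) (z : Lattice d) => clamp ε M (v (e z))) ?_
    fun v z => ⟨le_clamp _ _ _, clamp_le hεM _⟩
  exact continuous_pi fun z => (continuous_clamp ε M).comp (continuous_apply _)

/-- Truncation makes the property hold at every real sequence and every new value, as the
probabilistic lemmas require; an update before truncation is an update by a value in `[ε, M]` after
it. -/
theorem clampedRho_selfBounding {d : ℕ} (hd : 0 < d) {ε M : ℝ} (hε : 0 < ε) (hεM : ε ≤ M)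
    (e : Lattice d ≃ ℕ) (o x : Lattice d) (v : ℕ → ℝ) :
    ∃ b : ℕ → ℝ, (∀ i s, (clampedRho ε M e o x v
        - clampedRho ε M e o x (Function.update v i s)) ^ 2 ≤ b i) ∧
      ∀ n, ∑ i ∈ Finset.range n, b i ≤ selfBoundingConst ε M * clampedRho ε M e o x v := by
  obtain ⟨b, hb1, hb2⟩ := sum_sq_rho_update_sub_le hd hε (M := M)
    (v := fun z => clamp ε M (v (e z))) (fun z => le_clamp _ _ _) (fun z => clamp_le hεM _) o x
  refine ⟨fun i => b (e.symm i), fun i s => ?_, fun n => ?_⟩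
  · have hup : (fun z => clamp ε M (Function.update v i s (e z)))
        = Function.update (fun z => clamp ε M (v (e z))) (e.symm i) (clamp ε M s) := by
      funext z
      by_cases hz : z = e.symm i
      · subst hz; simp
      · have : e z ≠ i := fun h => hz (by rw [← h, e.symm_apply_apply])
        rw [Function.update_of_ne hz, Function.update_of_ne this]
    unfold clampedRho
    rw [add_sub_add_right_eq_sub, hup]
    exact hb1 _ _ (le_clamp _ _ _) (clamp_le hεM _)
  · have := hb2 ((Finset.range n).map e.symm.toEmbedding)
    rw [Finset.sum_map] at this
    exact this

theorem nonempty_lattice_equiv_nat {d : ℕ} (hd : 0 < d) : Nonempty (Lattice d ≃ ℕ) := by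
  have : Nonempty (Fin d) := ⟨⟨0, hd⟩⟩
  have : Infinite (Lattice d) := inferInstance
  obtain ⟨_⟩ := nonempty_denumerable (Lattice d)
  exact ⟨Denumerable.eqv _⟩

end RandomSchrodinger

theorem theorem1 :
    ∃ C : ℝ, 0 < C ∧ ∀ ε M : ℝ, 0 < ε → 0 < M →
      ∃ K : ℝ, 0 < K ∧
        ∀ (d : ℕ), 0 < d →
        ∀ (Ω : Type*) [MeasurableSpace Ω] (P : Measure Ω) [IsProbabilityMeasure P]
          (V : RandomSchrodinger.Lattice d → Ω → ℝ),
          (∀ z, Measurable (V z)) →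
          iIndepFun V P →
          (∀ z w, IdentDistrib (V z) (V w) P P) →
          (∀ z, ∀ᵐ ω ∂P, ε ≤ V z ω ∧ V z ω ≤ M) →
          ∀ (x : RandomSchrodinger.Lattice d) (ρ : Ω → ℝ) (μ : ℝ),
            (ρ = fun ω => RandomSchrodinger.rho (fun z => V z ω) 0 x) →
            (μ = ∫ ω, ρ ω ∂P) →
            Integrable ρ P ∧
            ∀ t : ℝ, 0 ≤ t →
              P.real {ω | ρ ω ≤ μ - t} ≤ C * Real.exp (-(t ^ 2 / (K * (μ + 1)))) ∧
              P.real {ω | μ + t ≤ ρ ω} ≤ C * Real.exp (-(t ^ 2 / (K * (μ + t + 1)))) := by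
  open RandomSchrodinger in
  -- The factor `8` is the one in `tails_of_mgf_le`, applied with mean `m = μ + 1`.
  refine ⟨1, one_pos, fun ε M hε hM => ⟨8 * selfBoundingConst ε M,
    mul_pos (by norm_num) (selfBoundingConst_pos hε hM), ?_⟩⟩
  intro d hd Ω _ P _ V hV hind _ hbd x ρ μ hρ hμ
  have hall : ∀ᵐ ω ∂P, ∀ z, ε ≤ V z ω ∧ V z ω ≤ M := ae_all_iff.2 hbd
  have hεM : ε ≤ M := by
    obtain ⟨ω, hω⟩ := hall.exists
    exact (hω 0).1.trans (hω 0).2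
  obtain ⟨e⟩ := nonempty_lattice_equiv_nat hd
  have hlow : ∀ (v : ℕ → ℝ) (z : Lattice d), ε ≤ clamp ε M (v (e z)) := fun v z => le_clamp _ _ _
  have hup : ∀ (v : ℕ → ℝ) (z : Lattice d), clamp ε M (v (e z)) ≤ M := fun v z => clamp_le hεM _
  obtain ⟨A, hA⟩ := rho_le hd hε hM (0 : Lattice d) x
  have hone : ∀ v, 1 ≤ clampedRho ε M e 0 x v := fun v =>
    le_add_of_nonneg_left (rho_nonneg hd hε (hlow v) (hup v) 0 x)
  have habs : ∀ v, |clampedRho ε M e 0 x v| ≤ A + 1 := fun v => by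
    rw [abs_of_nonneg (zero_le_one.trans (hone v))]
    exact add_le_add_left (hA _ (hlow v) (hup v)) 1
  have hcont := continuous_clampedRho hd hε hεM e 0 x
  set W : Ω → ℝ := fun ω => clampedRho ε M e 0 x fun i => V (e.symm i) ω with hWdef
  have hWb : BoundedMeasurable W :=
    ⟨hcont.measurable.comp (measurable_pi_iff.2 fun i => hV (e.symm i)), A + 1, fun ω => habs _⟩
  -- Almost surely all values of the potential lie in `[ε, M]`, so truncation changes nothing.
  have hρW : ρ =ᵐ[P] fun ω => W ω - 1 := by
    filter_upwards [hall] with ω hω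
    have : (fun z => clamp ε M (V (e.symm (e z)) ω)) = fun z => V z ω := by
      funext z
      rw [e.symm_apply_apply, clamp_of_mem (hω z).1 (hω z).2]
    rw [hρ]
    simp only [hWdef, clampedRho]
    rw [this, add_sub_cancel_right]
  have hμW : ∫ ω, W ω ∂P = μ + 1 := by
    rw [hμ, integral_congr_ae hρW, integral_sub (hWb.integrable P) (integrable_const _)]
    simp
  have hm : 0 < μ + 1 := by
    rw [← hμW]
    have := integral_mono (integrable_const (1 : ℝ)) (hWb.integrable P) fun ω => hone _
    simp only [integral_const, probReal_univ, smul_eq_mul, mul_one] at this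
    linarith
  refine ⟨((hWb.integrable P).sub (integrable_const 1)).congr hρW.symm, fun t ht => ?_⟩
  have htail := tails_of_mgf_le hWb (selfBoundingConst_pos hε hM) hm (fun l hl => by
    rw [← hμW]
    exact mgf_le_of_selfBounding (fun i => hV (e.symm i)) (hind.precomp e.symm.injective) hcont
      habs (selfBoundingConst_pos hε hM) (clampedRho_selfBounding hd hε hεM e 0 x) hl) ht
  have h1 : P.real {ω | ρ ω ≤ μ - t} = P.real {ω | W ω ≤ μ + 1 - t} := by
    refine measureReal_congr ?_
    filter_upwards [hρW] with ω hω
    refine propext ?_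
    change ρ ω ≤ μ - t ↔ W ω ≤ μ + 1 - t
    rw [hω]
    constructor <;> intro h <;> linarith
  have h2 : P.real {ω | μ + t ≤ ρ ω} = P.real {ω | μ + 1 + t ≤ W ω} := by
    refine measureReal_congr ?_
    filter_upwards [hρW] with ω hω
    refine propext ?_
    change μ + t ≤ ρ ω ↔ μ + 1 + t ≤ W ω
    rw [hω]
    constructor <;> intro h <;> linarith
  rw [h1, h2, one_mul, one_mul, add_right_comm μ t 1]
  exact htail
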